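/- Consider germs at $0\in\mathbb R^{2n}$, $n\ge 1$, all of them $C^\infty$ or, alternatively, all of them real-analytic. A triple $(\omega,\mathcal H,f)$ consists of (the germs at $0$ of) a symplectic form $\omega$, a hypersurface $\mathcal H=\{h=0\}$, where $h$ is a function with $h(0)=0$ and $dh(0)\neq 0$, and a function $f$ with $f(0)=0$. The triple is called non-singular if $\{f,h\}(0)\neq 0$, where $\{\cdot,\cdot\}$ is the Poisson bracket with respect to $\omega$. Two triples $(\omega_1,\mathcal H_1,f_1)$ and $(\omega_2,\mathcal H_2,f_2)$ are called equivalent if there is a local diffeomorphism $\Phi$ of $(\mathbb R^{2n},0)$, with $\Phi(0)=0$ and of the same class ($C^\infty$, respectively real-analytic), such that, near $0$, $\Phi^*\omega_2=\omega_1$, $\Phi(\mathcal H_1)=\mathcal H_2$ and $f_2\circ\Phi=f_1$. **Theorem (Arnol'd, Melrose).** Any non-singular triple $(\omega,\mathcal H,f)$ on $\mathbb R^{2n}$ is equivalent to the triple $$\omega=\sum_{i=1}^n dx_i\wedge dy_i,\qquad \mathcal H=\{x_1=0\},\qquad f=y_1 .$$ This holds both in the $C^\infty$ and in the real-analytic category.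 -/

import Mathlib

open Filter Topology
open scoped ContDiff

namespace SymplecticSemiSpace

noncomputable section

/-- The space `ℝ^{2n}` with coordinates `(x, y)`, where `x = (x₁, …, x_n)`, `y = (y₁, …, y_n)`. -/
abbrev PhaseSpace (n : ℕ) : Type := (Fin n → ℝ) × (Fin n → ℝ)

/-- Germs at the origin are given by representatives. The germ at `0` of `g` is of class `C^r`:
some representative is `C^r` on a whole neighbourhood of `0`.
For `r = ∞` these are the smooth germs, for `r = ω` the real-analytic ones. -/
def IsGerm {n : ℕ} {F : Type*} [NormedAddCommGroup F] [NormedSpace ℝ F]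
    (r : WithTop ℕ∞) (g : PhaseSpace n → F) : Prop :=
  ∃ U ∈ 𝓝 (0 : PhaseSpace n), ContDiffOn ℝ r g U

/-- Differential 2-forms on `ℝ^{2n}`. -/
abbrev TwoForm (n : ℕ) : Type := PhaseSpace n → PhaseSpace n [⋀^Fin 2]→L[ℝ] ℝ

/-- The map `v ↦ v ⌟ Ω` from vectors to covectors, for a 2-form `Ω` at a point. -/
def flat {n : ℕ} (Ω : PhaseSpace n [⋀^Fin 2]→L[ℝ] ℝ) :
    PhaseSpace n →L[ℝ] (PhaseSpace n →L[ℝ] ℝ) :=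
  (ContinuousAlternatingMap.ofSubsingletonLIE (𝕜 := ℝ) (E := PhaseSpace n) (F := ℝ)
    (0 : Fin 1)).symm.toContinuousLinearEquiv.toContinuousLinearMap ∘L Ω.curryLeft

theorem flat_apply {n : ℕ} (Ω : PhaseSpace n [⋀^Fin 2]→L[ℝ] ℝ) (v u : PhaseSpace n) :
    flat Ω v u = Ω ![v, u] := by
  change Ω (Matrix.vecCons v (fun _ => u)) = Ω ![v, u]
  congr 2
  ext i : 1
  fin_cases i
  rfl

/-- The germ at `0` of a symplectic form of class `C^r`: closed and nondegenerate near `0`. -/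
structure IsSymplectic {n : ℕ} (r : WithTop ℕ∞) (Ω : TwoForm n) : Prop where
  isGerm : IsGerm r Ω
  closed : ∀ᶠ p in 𝓝 (0 : PhaseSpace n), extDeriv Ω p = 0
  nondegenerate : ∀ᶠ p in 𝓝 (0 : PhaseSpace n),
    ∀ v : PhaseSpace n, (∀ u : PhaseSpace n, Ω p ![v, u] = 0) → v = 0

/-- The Hamiltonian vector field `Z_f`, the solution of `Z_f ⌟ Ω = df`
(at the points where `Ω` is nondegenerate). -/
def hamiltonianField {n : ℕ} (Ω : TwoForm n) (f : PhaseSpace n → ℝ) (p : PhaseSpace n) :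
    PhaseSpace n :=
  (flat (Ω p)).inverse (fderiv ℝ f p)

/-- The defining equation `Z_f ⌟ Ω = df` at each point where `Ω` is nondegenerate. -/
theorem apply_hamiltonianField {n : ℕ} (Ω : TwoForm n) (f : PhaseSpace n → ℝ) (p : PhaseSpace n)
    (hp : ∀ v : PhaseSpace n, (∀ u : PhaseSpace n, Ω p ![v, u] = 0) → v = 0)
    (u : PhaseSpace n) : Ω p ![hamiltonianField Ω f p, u] = fderiv ℝ f p u := by
  have hinj : Function.Injective (flat (Ω p) : PhaseSpace n →ₗ[ℝ] (PhaseSpace n →L[ℝ] ℝ)) := by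
    refine (injective_iff_map_eq_zero _).2 fun v hv => hp v fun u => ?_
    rw [← flat_apply]
    exact DFunLike.congr_fun hv u
  have hdim : Module.finrank ℝ (PhaseSpace n) = Module.finrank ℝ (PhaseSpace n →L[ℝ] ℝ) := by
    rw [← (LinearMap.toContinuousLinearMap :
      (PhaseSpace n →ₗ[ℝ] ℝ) ≃ₗ[ℝ] (PhaseSpace n →L[ℝ] ℝ)).finrank_eq]
    exact Subspace.dual_finrank_eq.symm
  let e : PhaseSpace n ≃L[ℝ] (PhaseSpace n →L[ℝ] ℝ) :=
    (LinearEquiv.ofInjectiveOfFinrankEq _ hinj hdim).toContinuousLinearEquiv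
  have he : (e : PhaseSpace n →L[ℝ] (PhaseSpace n →L[ℝ] ℝ)) = flat (Ω p) := by
    refine ContinuousLinearMap.ext fun v => ?_
    rfl
  rw [← flat_apply, hamiltonianField, ← he, ContinuousLinearMap.inverse_equiv]
  simp

/-- The Poisson bracket `{f, h} = Z_f(h) = dh(Z_f)` with respect to `Ω`. -/
def poissonBracket {n : ℕ} (Ω : TwoForm n) (f h : PhaseSpace n → ℝ) (p : PhaseSpace n) : ℝ :=
  fderiv ℝ h p (hamiltonianField Ω f p)

/-- `h` is a local equation at `0` of class `C^r` of the hypersurface germ `H`: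
`h(0) = 0`, `dh(0) ≠ 0` and `H = {h = 0}` near `0`. -/
structure IsLocalEquation {n : ℕ} (r : WithTop ℕ∞) (H : Set (PhaseSpace n))
    (h : PhaseSpace n → ℝ) : Prop where
  isGerm : IsGerm r h
  map_zero : h 0 = 0
  fderiv_ne_zero : fderiv ℝ h 0 ≠ 0
  mem_iff : ∀ᶠ p in 𝓝 (0 : PhaseSpace n), p ∈ H ↔ h p = 0

/-- The data of a triple: a 2-form, a subset and a function (each a representative of a germ
at `0`). -/
structure Triple (n : ℕ) where
  form : TwoForm n
  hypersurface : Set (PhaseSpace n)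
  function : PhaseSpace n → ℝ

/-- The triple consists of germs at `0` of a symplectic form, of a hypersurface through `0` without
singularities, and of a function vanishing at `0`, all of class `C^r`. -/
structure Triple.IsOfClass {n : ℕ} (r : WithTop ℕ∞) (T : Triple n) : Prop where
  symplectic : IsSymplectic r T.form
  hypersurface : ∃ h : PhaseSpace n → ℝ, IsLocalEquation r T.hypersurface h
  function : IsGerm r T.function
  function_zero : T.function 0 = 0

/-- A triple is non-singular if `{f, h}(0) ≠ 0` for a local equation `h` of the hypersurface. -/
def Triple.IsNonsingular {n : ℕ} (r : WithTop ℕ∞) (T : Triple n) : Prop :=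
  ∃ h : PhaseSpace n → ℝ, IsLocalEquation r T.hypersurface h ∧
    poissonBracket T.form T.function h 0 ≠ 0

/-- Two triples are equivalent in the class `C^r` if there is a local diffeomorphism `Φ` of
`(ℝ^{2n}, 0)`, of class `C^r` together with its inverse, such that near `0`
the pullback of the second form is the first form, `Φ` takes the first hypersurface to the second
one, and the second function composed with `Φ` is the first function. -/
def Triple.Equivalent {n : ℕ} (r : WithTop ℕ∞) (T₁ T₂ : Triple n) : Prop :=
  ∃ Φ : OpenPartialHomeomorph (PhaseSpace n) (PhaseSpace n),
    (0 : PhaseSpace n) ∈ Φ.source ∧ Φ 0 = 0 ∧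
    ContDiffOn ℝ r Φ Φ.source ∧ ContDiffOn ℝ r Φ.symm Φ.target ∧
    (∀ᶠ p in 𝓝 (0 : PhaseSpace n),
      (T₂.form (Φ p)).compContinuousLinearMap (fderiv ℝ Φ p) = T₁.form p) ∧
    (∀ᶠ p in 𝓝 (0 : PhaseSpace n), p ∈ T₁.hypersurface ↔ Φ p ∈ T₂.hypersurface) ∧
    (∀ᶠ p in 𝓝 (0 : PhaseSpace n), T₂.function (Φ p) = T₁.function p)

/-- The wedge product of two covectors. -/
def wedge {n : ℕ} (α β : PhaseSpace n →L[ℝ] ℝ) : PhaseSpace n [⋀^Fin 2]→L[ℝ] ℝ :=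
  ContinuousAlternatingMap.alternatizeUncurryFin
    (α.smulRight (ContinuousAlternatingMap.ofSubsingleton ℝ (PhaseSpace n) ℝ (0 : Fin 1) β))

theorem wedge_apply {n : ℕ} (α β : PhaseSpace n →L[ℝ] ℝ) (v u : PhaseSpace n) :
    wedge α β ![v, u] = α v * β u - α u * β v := by
  simp [wedge, ContinuousAlternatingMap.alternatizeUncurryFin_apply, Fin.sum_univ_two,
    Fin.removeNth, sub_eq_add_neg]

/-- The covector `dx_i`. -/
def dx {n : ℕ} (i : Fin n) : PhaseSpace n →L[ℝ] ℝ :=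
  ContinuousLinearMap.proj i ∘L ContinuousLinearMap.fst ℝ (Fin n → ℝ) (Fin n → ℝ)

/-- The covector `dy_i`. -/
def dy {n : ℕ} (i : Fin n) : PhaseSpace n →L[ℝ] ℝ :=
  ContinuousLinearMap.proj i ∘L ContinuousLinearMap.snd ℝ (Fin n → ℝ) (Fin n → ℝ)

/-- The normal form `Σ dx_i ∧ dy_i`, `{x₁ = 0}`, `y₁` (the first coordinate has index `0`). -/
def normalForm (n : ℕ) [NeZero n] : Triple n where
  form := fun _ => ∑ i : Fin n, wedge (dx i) (dy i)
  hypersurface := {p | p.1 0 = 0}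
  function := fun p => p.2 0

end

end SymplecticSemiSpace

/-!
The proof splits off one pair of conjugate coordinates and proceeds by induction on `n`.

Let `H = {h = 0}`. Since `{f, h}(0) ≠ 0`, the Hamiltonian field `Z_f` is transversal to `H`, while
the multiple `X = Z_h / Z_h(f)` of `Z_h` is tangent to `H` and satisfies `X(f) = 1`. The set
`{f = h = 0}` is a submanifold of codimension two; let `ι` parametrise it by `z ∈ ℝ^{2n-2}`. Then
`G(x, y, z) = φ_x (ψ_y (ι z))`, where `φ` and `ψ` are the flows of `Z_f` and `X`, is a local
diffeomorphism with `f ∘ G = y`, and `h ∘ G` vanishes exactly for `x = 0` (`exists_isAdapted`).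
The contraction of `η = G^*ω` with `∂/∂x` is `d(f ∘ G) = dy`. As `η` is closed, its coefficients
do not depend on `x`. On `{x = 0}` the contraction of `η` with `∂/∂y` is a multiple of `d(h ∘ G)`,
so it is `-dx`, there and hence everywhere, and the coefficients do not depend on `y` either. Thus
`η = dx ∧ dy + σ` with a symplectic form `σ` in the variables `z`
(`IsAdapted.eventually_pullback_eq`). A Darboux chart for `σ` then gives the normal form
(`exists_normalForm`); and such a chart exists by induction, because the normal form of any
non-singular triple with form `σ` provides one (`IsSymplectic.hasDarbouxChart`). Neither the
Poincaré lemma nor Moser's method is needed.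

The analytic input is that flows of vector fields of class `C^r` are of class `C^r` in time and
initial point, for `r = ∞` and `r = ω` alike (`SmoothNear.exists_flow`). The integral curves over
the time interval `[-ε, ε]`, rescaled to `[-1, 1]`, are the solutions `γ` of `γ = p + ε ∫ Z(γ)` in
the Banach space of continuous curves. The inverse function theorem applies to this equation, also
in the analytic category, because the operator `γ ↦ Z ∘ γ` is of class `C^r`
(`smoothNear_nemytskii`): for `r = ∞` by differentiating under composition, for `r = ω` by
applying the power series of `Z` pointwise.
-/

namespace SymplecticSemiSpace

/-! ### Germs of maps of class `C^r` -/

section Germs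

variable {E F G : Type*} [NormedAddCommGroup E] [NormedSpace ℝ E]
  [NormedAddCommGroup F] [NormedSpace ℝ F] [NormedAddCommGroup G] [NormedSpace ℝ G]
  {r : WithTop ℕ∞}

/-- `f` is of class `C^r` at every point near `x`. For `r = ∞` this is stronger than
`ContDiffAt ℝ r f x`, which allows the neighbourhood to shrink with the order of
differentiability. -/
def SmoothNear (r : WithTop ℕ∞) (f : E → F) (x : E) : Prop :=
  ∀ᶠ p in 𝓝 x, ContDiffAt ℝ r f p

theorem SmoothNear.self {f : E → F} {x : E} (hf : SmoothNear r f x) : ContDiffAt ℝ r f x :=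
  Eventually.self_of_nhds hf

theorem SmoothNear.continuousAt {f : E → F} {x : E} (hf : SmoothNear r f x) :
    ContinuousAt f x :=
  hf.self.continuousAt

theorem SmoothNear.eventually_differentiableAt {f : E → F} {x : E} (hf : SmoothNear r f x)
    (hr : r ≠ 0) : ∀ᶠ p in 𝓝 x, DifferentiableAt ℝ f p :=
  hf.mono fun _ hp => hp.differentiableAt hr

theorem smoothNear_of_contDiff {f : E → F} (hf : ContDiff ℝ r f) (x : E) : SmoothNear r f x :=
  Eventually.of_forall fun _ => hf.contDiffAt

theorem SmoothNear.comp {g : F → G} {f : E → F} {x : E} (hg : SmoothNear r g (f x))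
    (hf : SmoothNear r f x) : SmoothNear r (fun p => g (f p)) x := by
  filter_upwards [hf, hf.continuousAt.eventually hg] with p hp hgp
  exact ContDiffAt.comp p hgp hp

theorem SmoothNear.comp_of_eq {g : F → G} {f : E → F} {x : E} {y : F} (hg : SmoothNear r g y)
    (hf : SmoothNear r f x) (hxy : f x = y) : SmoothNear r (fun p => g (f p)) x := by
  subst hxy
  exact hg.comp hf

theorem SmoothNear.prodMk {f : E → F} {g : E → G} {x : E} (hf : SmoothNear r f x)
    (hg : SmoothNear r g x) : SmoothNear r (fun p => (f p, g p)) x := by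
  filter_upwards [hf, hg] with p hp hq
  exact hp.prodMk hq

theorem SmoothNear.clm_apply {f : E → F →L[ℝ] G} {g : E → F} {x : E} (hf : SmoothNear r f x)
    (hg : SmoothNear r g x) : SmoothNear r (fun p => f p (g p)) x := by
  filter_upwards [hf, hg] with p hp hq
  exact hp.clm_apply hq

theorem SmoothNear.fderiv_right {f : E → F} {x : E} (hf : SmoothNear r f x) (hr : r = ∞ ∨ r = ω) :
    SmoothNear r (fderiv ℝ f) x := by
  filter_upwards [hf] with p hp
  refine hp.fderiv_right ?_
  rcases hr with rfl | rfl <;> exact le_rfl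

theorem ne_zero_of_eq_infty_or_omega (hr : r = ∞ ∨ r = ω) : r ≠ 0 := by
  rcases hr with rfl | rfl <;> simp

theorem two_le_of_eq_infty_or_omega (hr : r = ∞ ∨ r = ω) : 2 ≤ r := by
  rcases hr with rfl | rfl
  · exact WithTop.coe_le_coe.2 (le_top : (2 : ℕ∞) ≤ ⊤)
  · exact le_top

theorem isGerm_iff_smoothNear {n : ℕ} {g : PhaseSpace n → F} :
    IsGerm r g ↔ SmoothNear r g 0 := by
  constructor
  · rintro ⟨U, hU, hg⟩
    filter_upwards [eventually_mem_nhds_iff.2 hU] with p hp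
    exact hg.contDiffAt hp
  · intro h
    exact ⟨_, h, fun p hp => ContDiffAt.contDiffWithinAt hp⟩

/-- Inverse function theorem for germs: the inverse is of class `C^r` on the whole of the
target. -/
theorem SmoothNear.exists_openPartialHomeomorph [CompleteSpace E] {f : E → F} {f' : E ≃L[ℝ] F}
    {x : E} (hf : SmoothNear r f x) (hr : r ≠ 0) (hf' : HasFDerivAt f (f' : E →L[ℝ] F) x) :
    ∃ Φ : OpenPartialHomeomorph E F, (Φ : E → F) = f ∧ x ∈ Φ.source ∧
      ContDiffOn ℝ r Φ Φ.source ∧ ContDiffOn ℝ r Φ.symm Φ.target := by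
  have hcont : ContinuousAt (fderiv ℝ f) x :=
    hf.self.continuousAt_fderiv hr
  have hinv : ∀ᶠ p in 𝓝 x, ∃ e : E ≃L[ℝ] F, (e : E →L[ℝ] F) = fderiv ℝ f p := by
    have hnhds := ContinuousLinearEquiv.nhds f'
    rw [← hf'.fderiv] at hnhds
    exact hcont.eventually hnhds
  obtain ⟨U, hU, hUo, hxU⟩ := eventually_nhds_iff.1 (hf.and hinv)
  let Φ := (hf.self.toOpenPartialHomeomorph f hf' hr).restrOpen U hUo
  have hsU : ∀ p ∈ Φ.source, p ∈ U := fun p hp => hp.2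
  refine ⟨Φ, rfl, ⟨hf.self.mem_toOpenPartialHomeomorph_source hf' hr, hxU⟩,
    fun p hp => (hU p (hsU p hp)).1.contDiffWithinAt, fun q hq => ?_⟩
  have hp := hU _ (hsU _ (Φ.map_target hq))
  obtain ⟨e, he⟩ := hp.2
  refine (Φ.contDiffAt_symm (f₀' := e) hq ?_ hp.1).contDiffWithinAt
  rw [he]
  exact (hp.1.differentiableAt hr).hasFDerivAt

/-- A function whose partial derivative in the first variable vanishes does not depend on that
variable. -/
theorem eventually_eq_of_hasDerivAt_zero {E : Type*} [NormedAddCommGroup E] {k : ℝ × E → F}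
    (hk : ∀ᶠ q in 𝓝 (0 : ℝ × E), HasDerivAt (fun s => k (s, q.2)) 0 q.1) :
    ∀ᶠ q in 𝓝 (0 : ℝ × E), k q = k (0, q.2) := by
  obtain ⟨δ, hδ, hb⟩ := Metric.eventually_nhds_iff_ball.1 hk
  filter_upwards [Metric.ball_mem_nhds 0 hδ] with q hq
  have hmem : ∀ s ∈ Metric.ball (0 : ℝ) δ, (s, q.2) ∈ Metric.ball (0 : ℝ × E) δ := by
    intro s hs
    simp only [mem_ball_zero_iff, Prod.norm_def, max_lt_iff] at hq hs ⊢
    exact ⟨hs, hq.2⟩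
  have hq1 : q.1 ∈ Metric.ball (0 : ℝ) δ := by
    simp only [mem_ball_zero_iff, Prod.norm_def, max_lt_iff] at hq ⊢
    exact hq.1
  have := (convex_ball (0 : ℝ) δ).norm_image_sub_le_of_norm_hasDerivWithin_le
    (f := fun s => k (s, q.2)) (f' := fun _ => 0) (C := 0)
    (fun s hs => (hb _ (hmem s hs)).hasDerivWithinAt) (by simp)
    (Metric.mem_ball_self hδ) hq1
  simpa [sub_eq_zero] using this

end Germs

/-! ### Composition operators on spaces of continuous curves -/

section Nemytskii

universe u

variable {I : Type*} [TopologicalSpace I] [CompactSpace I]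
  {E F : Type u} [NormedAddCommGroup E] [NormedSpace ℝ E] [NormedAddCommGroup F] [NormedSpace ℝ F]
  {r : WithTop ℕ∞}

open Classical in
/-- The composition (Nemytskii) operator `γ ↦ f ∘ γ` on continuous maps out of `I`, extended
by `0` to those `γ` for which `f ∘ γ` is not continuous. -/
noncomputable def nemytskii {I : Type*} [TopologicalSpace I] {E F : Type u}
    [NormedAddCommGroup E] [NormedAddCommGroup F] (f : E → F) (γ : C(I, E)) : C(I, F) :=
  if h : Continuous (f ∘ γ) then ⟨f ∘ γ, h⟩ else 0

theorem nemytskii_apply {I : Type*} [TopologicalSpace I] {E F : Type u} [NormedAddCommGroup E]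
    [NormedAddCommGroup F] {f : E → F} {γ : C(I, E)} {U : Set E} (hf : ContinuousOn f U)
    (hγ : ∀ s, γ s ∈ U) (s : I) : nemytskii f γ s = f (γ s) := by
  have h : Continuous (f ∘ γ) := hf.comp_continuous γ.continuous hγ
  simp [nemytskii, h]

/-- Pointwise evaluation of a continuous family of linear maps on a continuous family of
vectors. -/
noncomputable def pointwiseApply :
    C(I, E →L[ℝ] F) →L[ℝ] C(I, E) →L[ℝ] C(I, F) :=
  LinearMap.mkContinuous₂
    (LinearMap.mk₂ ℝ (fun (A : C(I, E →L[ℝ] F)) (v : C(I, E)) =>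
        (⟨fun s => A s (v s), by fun_prop⟩ : C(I, F)))
      (fun _ _ _ => by ext; simp) (fun _ _ _ => by ext; simp)
      (fun _ _ _ => by ext; simp) (fun _ _ _ => by ext; simp)) 1
    (fun A v => by
      rw [ContinuousMap.norm_le _ (by positivity), one_mul]
      intro s
      exact ((A s).le_opNorm _).trans (mul_le_mul (A.norm_coe_le_norm s) (v.norm_coe_le_norm s)
        (norm_nonneg _) (by positivity)))

@[simp]
theorem pointwiseApply_apply (A : C(I, E →L[ℝ] F)) (v : C(I, E)) (s : I) :
    pointwiseApply A v s = A s (v s) := rfl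

theorem isOpen_setOf_forall_mem {E : Type u} [NormedAddCommGroup E] {U : Set E} (hU : IsOpen U) :
    IsOpen {γ : C(I, E) | ∀ s, γ s ∈ U} := by
  simpa [Set.MapsTo] using ContinuousMap.isOpen_setOfPred_mapsTo (X := I) isCompact_univ hU

theorem continuousOn_nemytskii {E F : Type u} [NormedAddCommGroup E] [NormedAddCommGroup F]
    {f : E → F} {U : Set E} (hU : IsOpen U)
    (hf : ContinuousOn f U) :
    ContinuousOn (nemytskii f) {γ : C(I, E) | ∀ s, γ s ∈ U} := by
  intro γ hγ
  refine ContinuousAt.continuousWithinAt ?_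
  rw [Metric.continuousAt_iff']
  intro ε hε
  have hK : IsCompact (Set.range γ) := isCompact_range γ.continuous
  have := hK.uniformContinuousAt_of_continuousAt f
    (by rintro _ ⟨s, rfl⟩; exact hf.continuousAt (hU.mem_nhds (hγ s)))
    (Metric.dist_mem_uniformity (half_pos hε))
  obtain ⟨δ, hδ, h⟩ := Metric.mem_uniformity_dist.1 this
  filter_upwards [Metric.ball_mem_nhds γ hδ, (isOpen_setOf_forall_mem hU).mem_nhds hγ]
    with η hη hηU
  refine lt_of_le_of_lt ?_ (half_lt_self hε)
  rw [ContinuousMap.dist_le (half_pos hε).le]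
  intro s
  rw [nemytskii_apply hf hηU, nemytskii_apply hf hγ, dist_comm]
  refine (h (a := γ s) (b := η s) ?_ ⟨s, rfl⟩).le
  rw [dist_comm]
  exact (ContinuousMap.dist_apply_le_dist s).trans_lt hη

theorem hasFDerivAt_nemytskii {f : E → F} {U : Set E} (hU : IsOpen U)
    (hf : ContDiffOn ℝ 1 f U) {γ : C(I, E)} (hγ : ∀ s, γ s ∈ U) :
    HasFDerivAt (nemytskii f) (pointwiseApply (nemytskii (fderiv ℝ f) γ)) γ := by
  have hfd : ContinuousOn (fderiv ℝ f) U := hf.continuousOn_fderiv_of_isOpen hU le_rfl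
  rw [hasFDerivAt_iff_isLittleO, Asymptotics.isLittleO_iff]
  intro ε hε
  have hK : IsCompact (Set.range γ) := isCompact_range γ.continuous
  obtain ⟨δ₁, hδ₁, h₁⟩ := hK.exists_thickening_subset_open hU
    (by rintro _ ⟨s, rfl⟩; exact hγ s)
  have := hK.uniformContinuousAt_of_continuousAt (fderiv ℝ f)
    (by rintro _ ⟨s, rfl⟩; exact hfd.continuousAt (hU.mem_nhds (hγ s)))
    (Metric.dist_mem_uniformity hε)
  obtain ⟨δ₂, hδ₂, h₂⟩ := Metric.mem_uniformity_dist.1 this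
  filter_upwards [Metric.ball_mem_nhds γ hδ₁, Metric.ball_mem_nhds γ hδ₂,
    (isOpen_setOf_forall_mem hU).mem_nhds hγ] with η hη₁ hη₂ hηU
  rw [ContinuousMap.norm_le _ (by positivity)]
  intro s
  have hs₁ : dist (η s) (γ s) < δ₁ := (ContinuousMap.dist_apply_le_dist s).trans_lt hη₁
  have hs₂ : dist (η s) (γ s) < δ₂ := (ContinuousMap.dist_apply_le_dist s).trans_lt hη₂
  have key := (convex_ball (γ s) (min δ₁ δ₂)).norm_image_sub_le_of_norm_hasFDerivWithin_le'
    (f := f) (f' := fderiv ℝ f) (φ := fderiv ℝ f (γ s)) (C := ε) (x := γ s) (y := η s)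
    (fun y hy => by
      have hyU : y ∈ U := h₁ (Metric.mem_thickening_iff.2
        ⟨γ s, ⟨s, rfl⟩, hy.trans_le (min_le_left _ _)⟩)
      exact ((hf.contDiffAt (hU.mem_nhds hyU)).differentiableAt
        one_ne_zero).hasFDerivAt.hasFDerivWithinAt)
    (fun y hy => by
      rw [← dist_eq_norm, dist_comm]
      refine (h₂ (a := γ s) (b := y) ?_ ⟨s, rfl⟩).le
      rw [dist_comm]
      exact Metric.mem_ball.1 hy |>.trans_le (min_le_right _ _))
    (Metric.mem_ball_self (lt_min hδ₁ hδ₂)) (Metric.mem_ball.2 (lt_min hs₁ hs₂))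
  simp only [ContinuousMap.sub_apply, pointwiseApply_apply]
  rw [nemytskii_apply hf.continuousOn hηU, nemytskii_apply hf.continuousOn hγ,
    nemytskii_apply hfd hγ]
  refine key.trans ?_
  gcongr
  exact (η - γ).norm_coe_le_norm s

theorem contDiffOn_nemytskii_nat (n : ℕ) {F : Type u} [NormedAddCommGroup F] [NormedSpace ℝ F]
    {f : E → F} {U : Set E} (hU : IsOpen U) (hf : ContDiffOn ℝ n f U) :
    ContDiffOn ℝ n (nemytskii f) {γ : C(I, E) | ∀ s, γ s ∈ U} := by
  induction n generalizing F with
  | zero =>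
    simp only [Nat.cast_zero, contDiffOn_zero] at hf ⊢
    exact continuousOn_nemytskii hU hf
  | succ n ih =>
    have hf1 : ContDiffOn ℝ 1 f U := hf.of_le (by exact_mod_cast Nat.le_add_left 1 n)
    push_cast at hf ⊢
    rw [contDiffOn_succ_iff_fderiv_of_isOpen hU] at hf
    rw [contDiffOn_succ_iff_fderiv_of_isOpen (isOpen_setOf_forall_mem hU)]
    refine ⟨fun γ hγ => (hasFDerivAt_nemytskii hU hf1 hγ).differentiableAt.differentiableWithinAt,
      by simp, ?_⟩
    refine ContDiffOn.congr (f := fun γ => pointwiseApply (nemytskii (fderiv ℝ f) γ)) ?_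
      fun γ hγ => (hasFDerivAt_nemytskii hU hf1 hγ).fderiv
    exact pointwiseApply.contDiff.comp_contDiffOn (ih hf.2.2)

/-- A continuous multilinear map, applied pointwise to continuous curves. -/
noncomputable def pointwiseMultilinear {k : ℕ} (p : E [×k]→L[ℝ] F) :
    C(I, E) [×k]→L[ℝ] C(I, F) :=
  MultilinearMap.mkContinuous
    { toFun := fun v => (⟨fun s => p fun i => v i s, by fun_prop⟩ : C(I, F))
      map_update_add' := fun v i x y => by
        ext s
        have (z : C(I, E)) : (fun j => Function.update v i z j s) =
            Function.update (fun j => v j s) i (z s) := by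
          ext j; by_cases h : j = i <;> [(subst h; simp); simp [h]]
        simp [this]
      map_update_smul' := fun v i c x => by
        ext s
        have (z : C(I, E)) : (fun j => Function.update v i z j s) =
            Function.update (fun j => v j s) i (z s) := by
          ext j; by_cases h : j = i <;> [(subst h; simp); simp [h]]
        simp [this] } ‖p‖
    (fun v => by
      refine (ContinuousMap.norm_le _ (by positivity)).2 fun s => ?_
      refine (p.le_opNorm _).trans ?_
      gcongr with i
      exact (v i).norm_coe_le_norm s)

theorem norm_pointwiseMultilinear_le {k : ℕ} (p : E [×k]→L[ℝ] F) :
    ‖(pointwiseMultilinear p : C(I, E) [×k]→L[ℝ] C(I, F))‖ ≤ ‖p‖ :=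
  MultilinearMap.mkContinuous_norm_le _ (norm_nonneg _) _

/-- If `f` is the sum of a power series at `0`, then `γ ↦ f ∘ γ` is the sum of the power series
whose terms are the terms of the former applied pointwise. -/
theorem analyticAt_nemytskii [CompleteSpace F] {f : E → F} (hf : AnalyticAt ℝ f 0) :
    AnalyticAt ℝ (nemytskii f) (0 : C(I, E)) := by
  obtain ⟨p, ρ, hp⟩ := hf
  have hcont : ContinuousOn f (Metric.eball 0 ρ) := hp.continuousOn
  have hle : p.radius ≤ FormalMultilinearSeries.radius
      (fun k => (pointwiseMultilinear (p k) : C(I, E) [×k]→L[ℝ] C(I, F))) :=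
    FormalMultilinearSeries.radius_le_of_le fun k => norm_pointwiseMultilinear_le (p k)
  refine ⟨fun k => pointwiseMultilinear (p k), ρ, hp.r_le.trans hle, hp.r_pos, fun {γ} hγ => ?_⟩
  have hγs : ∀ s, γ s ∈ Metric.eball 0 ρ := by
    intro s
    simp only [Metric.mem_eball, edist_zero_right] at hγ ⊢
    refine lt_of_le_of_lt ?_ hγ
    rw [← ofReal_norm, ← ofReal_norm]
    exact ENNReal.ofReal_le_ofReal (γ.norm_coe_le_norm s)
  have hsum : Summable fun k => pointwiseMultilinear (p k) fun _ : Fin k => γ :=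
    FormalMultilinearSeries.summable (𝕜 := ℝ)
      (p := fun k => (pointwiseMultilinear (p k) : C(I, E) [×k]→L[ℝ] C(I, F)))
      (Metric.eball_subset_eball (hp.r_le.trans hle) hγ)
  have heq : nemytskii f (0 + γ) = ∑' k, pointwiseMultilinear (p k) fun _ : Fin k => γ := by
    ext s
    rw [zero_add, nemytskii_apply hcont hγs]
    have h1 := hp.hasSum (hγs s)
    rw [zero_add] at h1
    exact h1.unique (ContinuousMap.hasSum_apply hsum.hasSum s)
  rw [heq]
  exact hsum.hasSum

theorem smoothNear_nemytskii [CompleteSpace F] {f : E → F} (hf : SmoothNear r f 0)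
    (hr : r = ∞ ∨ r = ω) : SmoothNear r (nemytskii f) (0 : C(I, E)) := by
  rcases hr with rfl | rfl
  · obtain ⟨U, hU, hUo, h0⟩ := eventually_nhds_iff.1 hf
    have hfU : ContDiffOn ℝ ∞ f U := fun p hp => (hU p hp).contDiffWithinAt
    have : ContDiffOn ℝ ∞ (nemytskii f) {γ : C(I, E) | ∀ s, γ s ∈ U} :=
      contDiffOn_infty.2 fun n => contDiffOn_nemytskii_nat n hUo (contDiffOn_infty.1 hfU n)
    filter_upwards [(isOpen_setOf_forall_mem hUo).mem_nhds (show (0 : C(I, E)) ∈ _ from fun _ => h0)]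
      with γ hγ
    exact this.contDiffAt ((isOpen_setOf_forall_mem hUo).mem_nhds hγ)
  · filter_upwards [(analyticAt_nemytskii (I := I) hf.self.analyticAt).eventually_analyticAt]
      with γ hγ
    exact hγ.contDiffAt

end Nemytskii

/-! ### Flows of vector fields depend on time and initial point in the class `C^r` -/

section Flow

universe u

variable {E : Type u} [NormedAddCommGroup E] [NormedSpace ℝ E] {r : WithTop ℕ∞}

/-- The time interval `[-1, 1]`. -/
abbrev TimeInterval : Type := Set.Icc (-1 : ℝ) 1

/-- The projection of the real line onto `[-1, 1]`. -/
noncomputable def timeProj : ℝ → TimeInterval := Set.projIcc (-1 : ℝ) 1 (by norm_num)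

theorem continuous_timeProj : Continuous timeProj := continuous_projIcc

theorem timeProj_of_mem {t : ℝ} (ht : t ∈ Set.Icc (-1 : ℝ) 1) : timeProj t = ⟨t, ht⟩ :=
  Set.projIcc_of_mem _ ht

/-- The operator `γ ↦ (s ↦ ∫₀ˢ γ)` on continuous curves over `[-1, 1]`. -/
noncomputable def primitive : C(TimeInterval, E) →L[ℝ] C(TimeInterval, E) :=
  LinearMap.mkContinuous
    { toFun := fun γ => ⟨fun s => ∫ t in (0 : ℝ)..s, γ (timeProj t),
        (intervalIntegral.continuous_primitive
          (fun a b => (γ.continuous.comp continuous_timeProj).intervalIntegrable a b) 0).comp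
          continuous_subtype_val⟩
      map_add' := fun γ η => by
        ext s
        exact intervalIntegral.integral_add
          ((γ.continuous.comp continuous_timeProj).intervalIntegrable _ _)
          ((η.continuous.comp continuous_timeProj).intervalIntegrable _ _)
      map_smul' := fun c γ => by
        ext s
        exact intervalIntegral.integral_smul c _ } 1
    (fun γ => by
      rw [one_mul, ContinuousMap.norm_le _ (norm_nonneg _)]
      intro s
      refine (intervalIntegral.norm_integral_le_of_norm_le_const
        fun t _ => γ.norm_coe_le_norm (timeProj t)).trans ?_
      have : |(s : ℝ) - 0| ≤ 1 := by rw [sub_zero]; exact abs_le.2 s.2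
      exact mul_le_of_le_one_right (norm_nonneg _) this)

theorem primitive_apply (γ : C(TimeInterval, E)) (s : TimeInterval) :
    primitive γ s = ∫ t in (0 : ℝ)..s, γ (timeProj t) := rfl

/-- Constant curves. -/
noncomputable def constCurve : E →L[ℝ] C(TimeInterval, E) :=
  LinearMap.mkContinuous
    { toFun := ContinuousMap.const _
      map_add' := fun _ _ => rfl
      map_smul' := fun _ _ => rfl } 1
    (fun p => by
      rw [one_mul]
      exact (ContinuousMap.norm_le _ (norm_nonneg _)).2 fun _ => le_rfl)

@[simp]
theorem constCurve_apply (p : E) (s : TimeInterval) : constCurve p s = p := rfl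

/-- Reparametrisation of a curve by the factor `c ∈ [-1, 1]`. -/
noncomputable def rescale (c : TimeInterval) (γ : C(TimeInterval, E)) : C(TimeInterval, E) :=
  ⟨fun s => γ (timeProj (c * s)), γ.continuous.comp (continuous_timeProj.comp (by fun_prop))⟩

theorem mul_mem_timeInterval (c s : TimeInterval) : (c * s : ℝ) ∈ Set.Icc (-1 : ℝ) 1 := by
  rw [Set.mem_Icc, ← abs_le, abs_mul]
  exact mul_le_one₀ (abs_le.2 c.2) (abs_nonneg _) (abs_le.2 s.2)

theorem primitive_rescale (c : TimeInterval) (γ : C(TimeInterval, E)) (s : TimeInterval) :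
    primitive γ (timeProj (c * s)) = (c : ℝ) • primitive (rescale c γ) s := by
  rw [primitive_apply, primitive_apply, timeProj_of_mem (mul_mem_timeInterval c s)]
  have h : ∀ t ∈ Set.uIcc (0 : ℝ) s, rescale c γ (timeProj t) = γ (timeProj (c * t)) := by
    intro t ht
    have ht' : t ∈ Set.Icc (-1 : ℝ) 1 :=
      Set.uIcc_subset_Icc (by norm_num) s.2 ht
    rw [timeProj_of_mem ht']
    rfl
  rw [intervalIntegral.integral_congr h,
    intervalIntegral.smul_integral_comp_mul_left (fun t => γ (timeProj t)) (c : ℝ), mul_zero]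

/-- The map `(ε, p, γ) ↦ (ε, p, γ - p - ε ∫ Z(γ))`. The curve `γ` solves `γ' = ε Z(γ)`,
`γ(0) = p` if and only if the last component vanishes. -/
noncomputable def picardMap (Z : E → E) (q : ℝ × E × C(TimeInterval, E)) :
    ℝ × E × C(TimeInterval, E) :=
  (q.1, q.2.1, q.2.2 - constCurve q.2.1 - q.1 • primitive (nemytskii Z q.2.2))

theorem smoothNear_picardMap [CompleteSpace E] {Z : E → E} (hr : r = ∞ ∨ r = ω)
    (hZ : SmoothNear r Z 0) : SmoothNear r (picardMap Z) 0 := by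
  have h : SmoothNear r (fun q : ℝ × E × C(TimeInterval, E) => nemytskii Z q.2.2) 0 :=
    (smoothNear_nemytskii hZ hr).comp_of_eq (smoothNear_of_contDiff (by fun_prop) _) rfl
  filter_upwards [h] with q hq
  have hq' : ContDiffAt ℝ r (fun q : ℝ × E × C(TimeInterval, E) =>
      primitive (nemytskii Z q.2.2)) q := (primitive (E := E)).contDiff.contDiffAt.comp q hq
  unfold picardMap
  have hc : ContDiffAt ℝ r (fun q : ℝ × E × C(TimeInterval, E) => constCurve q.2.1) q :=
    (constCurve (E := E)).contDiff.contDiffAt.comp q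
      (contDiffAt_fst.comp q contDiffAt_snd)
  fun_prop

/-- The shear `(ε, p, γ) ↦ (ε, p, γ - p - ε w)`, which is the derivative of `picardMap`
at the origin for a suitable `w`. -/
noncomputable def picardEquiv (w : C(TimeInterval, E)) :
    (ℝ × E × C(TimeInterval, E)) ≃L[ℝ] ℝ × E × C(TimeInterval, E) where
  toFun q := (q.1, q.2.1, q.2.2 - constCurve q.2.1 - q.1 • w)
  invFun q := (q.1, q.2.1, q.2.2 + constCurve q.2.1 + q.1 • w)
  map_add' a b := by
    refine Prod.ext rfl (Prod.ext rfl ?_)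
    simp only [Prod.fst_add, Prod.snd_add, map_add, add_smul]
    abel
  map_smul' c a := by
    refine Prod.ext rfl (Prod.ext rfl ?_)
    simp only [Prod.smul_fst, Prod.smul_snd, map_smul, RingHom.id_apply, smul_sub, smul_eq_mul,
      mul_smul]
  left_inv q := Prod.ext rfl (Prod.ext rfl (by simp only []; abel))
  right_inv q := Prod.ext rfl (Prod.ext rfl (by simp only []; abel))
  continuous_toFun := by fun_prop
  continuous_invFun := by fun_prop

theorem hasFDerivAt_picardMap [CompleteSpace E] {Z : E → E} (hr : r = ∞ ∨ r = ω)
    (hZ : SmoothNear r Z 0) :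
    HasFDerivAt (picardMap Z)
      (picardEquiv (primitive (nemytskii Z 0)) :
        (ℝ × E × C(TimeInterval, E)) →L[ℝ] ℝ × E × C(TimeInterval, E)) 0 := by
  have hN : DifferentiableAt ℝ (nemytskii Z : C(TimeInterval, E) → C(TimeInterval, E)) 0 :=
    (smoothNear_nemytskii hZ hr).self.differentiableAt (ne_zero_of_eq_infty_or_omega hr)
  have h2 : HasFDerivAt (fun q : ℝ × E × C(TimeInterval, E) => q.2.2)
      ((ContinuousLinearMap.snd ℝ E C(TimeInterval, E)).comp
        (ContinuousLinearMap.snd ℝ ℝ (E × C(TimeInterval, E)))) 0 :=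
    hasFDerivAt_snd.comp (0 : ℝ × E × C(TimeInterval, E)) hasFDerivAt_snd
  have h1 : HasFDerivAt (fun q : ℝ × E × C(TimeInterval, E) => q.2.1)
      ((ContinuousLinearMap.fst ℝ E C(TimeInterval, E)).comp
        (ContinuousLinearMap.snd ℝ ℝ (E × C(TimeInterval, E)))) 0 :=
    hasFDerivAt_fst.comp (0 : ℝ × E × C(TimeInterval, E)) hasFDerivAt_snd
  have h0 : HasFDerivAt (fun q : ℝ × E × C(TimeInterval, E) => q.1)
      (ContinuousLinearMap.fst ℝ ℝ (E × C(TimeInterval, E))) 0 :=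
    hasFDerivAt_fst
  have hP := (primitive (E := E)).hasFDerivAt.comp (0 : ℝ × E × C(TimeInterval, E))
    (HasFDerivAt.comp (0 : ℝ × E × C(TimeInterval, E)) (g := nemytskii Z) hN.hasFDerivAt h2)
  have hC := (constCurve (E := E)).hasFDerivAt.comp (0 : ℝ × E × C(TimeInterval, E)) h1
  refine (h0.prodMk (h1.prodMk ((h2.sub hC).sub (h0.smul hP)))).congr_fderiv ?_
  ext <;> simp [picardEquiv]

/-- A local flow of a vector field of class `C^r` is of class `C^r` jointly in time and
initial point. The rescaled integral curves `s ↦ φ(ε s, p)`, `|s| ≤ 1`, are the solutions `γ` of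
`picardMap Z (ε, p, γ) = (ε, p, 0)`, and the inverse function theorem applies. -/
theorem SmoothNear.exists_flow [CompleteSpace E] {Z : E → E} (hr : r = ∞ ∨ r = ω)
    (hZ : SmoothNear r Z 0) :
    ∃ φ : ℝ × E → E, SmoothNear r φ 0 ∧ (∀ᶠ p in 𝓝 (0 : E), φ (0, p) = p) ∧
      ∀ᶠ q in 𝓝 (0 : ℝ × E), HasDerivAt (fun s => φ (s, q.2)) (Z (φ q)) q.1 := by
  have hr0 := ne_zero_of_eq_infty_or_omega hr
  obtain ⟨U, hU, hUo, h0U⟩ := eventually_nhds_iff.1 hZ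
  have hZU : ContinuousOn Z U := fun p hp => (hU p hp).continuousAt.continuousWithinAt
  obtain ⟨Θ, hΘ, h0Θ, -, hΘs⟩ := (smoothNear_picardMap hr hZ).exists_openPartialHomeomorph hr0
    (hasFDerivAt_picardMap hr hZ)
  have hΘ0 : Θ 0 = 0 := by rw [hΘ]; simp [picardMap]
  have hΘ0' : Θ.symm 0 = 0 := by
    conv_lhs => rw [← hΘ0]
    exact Θ.left_inv h0Θ
  have h0t : (0 : ℝ × E × C(TimeInterval, E)) ∈ Θ.target := hΘ0 ▸ Θ.map_source h0Θ
  let incl : ℝ × E → ℝ × E × C(TimeInterval, E) := fun q => (q.1, q.2, 0)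
  let Γ : ℝ × E → C(TimeInterval, E) := fun q => (Θ.symm (incl q)).2.2
  have hincl : ContDiff ℝ r incl := by fun_prop
  have hsymm : SmoothNear r Θ.symm 0 := by
    filter_upwards [Θ.open_target.mem_nhds h0t] with q hq
    exact hΘs.contDiffAt (Θ.open_target.mem_nhds hq)
  have hsymmincl : SmoothNear r (fun q => Θ.symm (incl q)) 0 :=
    hsymm.comp_of_eq (smoothNear_of_contDiff hincl 0) rfl
  -- a ball on which `picardMap` is injective and the curves stay in the domain of `Z`
  have hS : ∀ᶠ q in 𝓝 (0 : ℝ × E × C(TimeInterval, E)), q ∈ Θ.source ∧ ∀ s, q.2.2 s ∈ U := by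
    refine Filter.Eventually.and (Θ.open_source.mem_nhds h0Θ) ?_
    have hop : IsOpen {γ : C(TimeInterval, E) | ∀ s, γ s ∈ U} := isOpen_setOf_forall_mem hUo
    have h0 : {γ : C(TimeInterval, E) | ∀ s, γ s ∈ U} ∈ 𝓝 (0 : C(TimeInterval, E)) :=
      hop.mem_nhds fun _ => h0U
    have hc : Tendsto (fun q : ℝ × E × C(TimeInterval, E) => q.2.2) (𝓝 0) (𝓝 0) :=
      (continuous_snd.comp continuous_snd).tendsto' _ _ rfl
    exact hc.eventually h0
  obtain ⟨δ, hδ, hball⟩ := Metric.eventually_nhds_iff_ball.1 hS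
  have hev : ∀ᶠ q in 𝓝 (0 : ℝ × E), incl q ∈ Θ.target ∧ Θ.symm (incl q) ∈ Metric.ball 0 δ := by
    refine (hincl.continuous.continuousAt.eventually (Θ.open_target.mem_nhds h0t)).and ?_
    have hc : Tendsto (fun q => Θ.symm (incl q)) (𝓝 0) (𝓝 0) := by
      have h := hsymmincl.continuousAt.tendsto
      rwa [show Θ.symm (incl 0) = 0 from hΘ0'] at h
    exact hc.eventually (Metric.ball_mem_nhds _ hδ)
  obtain ⟨ρ, hρ, hev⟩ := Metric.eventually_nhds_iff_ball.1 hev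
  have hΓ : ∀ q ∈ Metric.ball (0 : ℝ × E) ρ, Θ.symm (incl q) = (q.1, q.2, Γ q) ∧
      Γ q = constCurve q.2 + q.1 • primitive (nemytskii Z (Γ q)) := by
    intro q hq
    have h := Θ.right_inv (hev q hq).1
    rw [hΘ] at h
    have h1 : (Θ.symm (incl q)).1 = q.1 := congrArg Prod.fst h
    have h2 : (Θ.symm (incl q)).2.1 = q.2 := congrArg (fun z => z.2.1) h
    have h3 : Γ q - constCurve (Θ.symm (incl q)).2.1 -
      (Θ.symm (incl q)).1 • primitive (nemytskii Z (Γ q)) = 0 := congrArg (fun z => z.2.2) h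
    rw [h1, h2, sub_sub, sub_eq_zero] at h3
    exact ⟨Prod.ext h1 (Prod.ext h2 rfl), h3⟩
  have hΓU : ∀ q ∈ Metric.ball (0 : ℝ × E) ρ, ∀ s, Γ q s ∈ U := fun q hq =>
    (hball _ (hev q hq).2).2
  -- by injectivity, rescaling the time amounts to rescaling the parameter `ε`
  have hscale : ∀ q ∈ Metric.ball (0 : ℝ × E) ρ, ∀ c : TimeInterval,
      Γ (c * q.1, q.2) = rescale c (Γ q) := by
    intro q hq c
    have hc : |(c : ℝ)| ≤ 1 := abs_le.2 c.2
    have hcq : ((c * q.1, q.2) : ℝ × E) ∈ Metric.ball (0 : ℝ × E) ρ := by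
      simp only [mem_ball_zero_iff, Prod.norm_def, max_lt_iff, norm_mul, Real.norm_eq_abs] at hq ⊢
      exact ⟨(mul_le_of_le_one_left (abs_nonneg _) hc).trans_lt hq.1, hq.2⟩
    have hmem : ((c * q.1, q.2, rescale c (Γ q)) : ℝ × E × C(TimeInterval, E)) ∈
        Metric.ball 0 δ := by
      have h := (hev q hq).2
      rw [(hΓ q hq).1] at h
      simp only [mem_ball_zero_iff, Prod.norm_def, max_lt_iff, norm_mul, Real.norm_eq_abs] at h ⊢
      refine ⟨(mul_le_of_le_one_left (abs_nonneg _) hc).trans_lt h.1, h.2.1, ?_⟩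
      refine lt_of_le_of_lt ?_ h.2.2
      exact (ContinuousMap.norm_le _ (norm_nonneg _)).2 fun s => (Γ q).norm_coe_le_norm _
    have hN : nemytskii Z (rescale c (Γ q)) = rescale c (nemytskii Z (Γ q)) := by
      ext s
      exact (nemytskii_apply (γ := rescale c (Γ q)) hZU (fun s => hΓU q hq _) s).trans
        (nemytskii_apply hZU (hΓU q hq) _).symm
    have himg : Θ (c * q.1, q.2, rescale c (Γ q)) = incl (c * q.1, q.2) := by
      rw [hΘ]
      refine Prod.ext rfl (Prod.ext rfl ?_)
      change rescale c (Γ q) - constCurve q.2 -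
        (c * q.1) • primitive (nemytskii Z (rescale c (Γ q))) = 0
      rw [sub_sub, sub_eq_zero, hN]
      ext s
      have h := DFunLike.congr_fun (hΓ q hq).2 (timeProj (c * s))
      simp only [ContinuousMap.add_apply, ContinuousMap.smul_apply, constCurve_apply,
        primitive_rescale] at h ⊢
      rw [mul_comm, mul_smul]
      exact h
    have h := Θ.left_inv (hball _ hmem).1
    rw [himg, (hΓ _ hcq).1] at h
    exact congrArg (fun z => z.2.2) h
  let one : TimeInterval := ⟨1, by norm_num⟩
  refine ⟨fun q => Γ q one, ?_, ?_, ?_⟩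
  · have hev1 : ContDiff ℝ r (fun z : ℝ × E × C(TimeInterval, E) =>
        ContinuousMap.evalCLM ℝ one z.2.2) :=
      (ContinuousMap.evalCLM (M := E) ℝ one).contDiff.comp
        ((contDiff_snd (E := E)).comp (contDiff_snd (E := ℝ)))
    exact (smoothNear_of_contDiff hev1 _).comp hsymmincl
  · have : ContinuousAt (fun p : E => ((0, p) : ℝ × E)) 0 := by fun_prop
    filter_upwards [this.eventually (Metric.ball_mem_nhds (0 : ℝ × E) hρ)] with p hp
    have h := DFunLike.congr_fun (hΓ _ hp).2 one
    simpa using h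
  · filter_upwards [Metric.ball_mem_nhds (0 : ℝ × E) (half_pos hρ)] with q hq
    rw [mem_ball_zero_iff, Prod.norm_def, max_lt_iff, Real.norm_eq_abs] at hq
    set ε : ℝ := ρ / 2 with hε
    have hε0 : 0 < ε := half_pos hρ
    have hεq : ((ε, q.2) : ℝ × E) ∈ Metric.ball (0 : ℝ × E) ρ := by
      rw [mem_ball_zero_iff, Prod.norm_def, max_lt_iff, Real.norm_eq_abs, abs_of_pos hε0]
      exact ⟨half_lt_self hρ, hq.2.trans (half_lt_self hρ)⟩
    have hcurve : ∀ s : ℝ, |s| < ε → Γ (s, q.2) one = Γ (ε, q.2) (timeProj (ε⁻¹ * s)) := by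
      intro s hs
      have hmem : ε⁻¹ * s ∈ Set.Icc (-1 : ℝ) 1 := by
        rw [Set.mem_Icc, ← abs_le, abs_mul, abs_of_pos (inv_pos.2 hε0), inv_mul_le_one₀ hε0]
        exact hs.le
      have h := hscale _ hεq ⟨ε⁻¹ * s, hmem⟩
      have hs' : ε⁻¹ * s * ε = s := by field_simp
      simp only [hs'] at h
      rw [h]
      simp [rescale, one]
    have hint : ∀ s : ℝ, |s| < ε → Γ (s, q.2) one =
        q.2 + ε • ∫ t in (0 : ℝ)..(ε⁻¹ * s), nemytskii Z (Γ (ε, q.2)) (timeProj t) := by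
      intro s hs
      rw [hcurve s hs]
      have hmem : ε⁻¹ * s ∈ Set.Icc (-1 : ℝ) 1 := by
        rw [Set.mem_Icc, ← abs_le, abs_mul, abs_of_pos (inv_pos.2 hε0), inv_mul_le_one₀ hε0]
        exact hs.le
      have h := DFunLike.congr_fun (hΓ _ hεq).2 (timeProj (ε⁻¹ * s))
      rw [ContinuousMap.add_apply, ContinuousMap.smul_apply, constCurve_apply,
        primitive_apply, timeProj_of_mem hmem] at h
      rw [timeProj_of_mem hmem]
      exact h
    have hderiv : HasDerivAt (fun s : ℝ => q.2 + ε • ∫ t in (0 : ℝ)..(ε⁻¹ * s),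
        nemytskii Z (Γ (ε, q.2)) (timeProj t)) (Z (Γ q one)) q.1 := by
      have hcont : Continuous fun t => nemytskii Z (Γ (ε, q.2)) (timeProj t) :=
        (nemytskii Z (Γ (ε, q.2))).continuous.comp continuous_timeProj
      have h1 : HasDerivAt (fun s : ℝ => ε⁻¹ * s) ε⁻¹ q.1 := by
        simpa using (hasDerivAt_id q.1).const_mul ε⁻¹
      have h2 := (hcont.integral_hasStrictDerivAt 0 (ε⁻¹ * q.1)).hasDerivAt.scomp q.1 h1
      have h3 := (h2.const_smul ε).const_add q.2
      rw [smul_smul, mul_inv_cancel₀ hε0.ne', one_smul, nemytskii_apply hZU (hΓU _ hεq),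
        ← hcurve q.1 hq.1] at h3
      exact h3
    refine hderiv.congr_of_eventuallyEq ?_
    filter_upwards [continuous_abs.continuousAt.eventually_lt continuousAt_const hq.1] with s hs
    exact hint s hs

end Flow

/-! ### Closed two-forms and Hamiltonian vector fields -/

section Forms

variable {E V : Type*} [NormedAddCommGroup E] [NormedSpace ℝ E]
  [NormedAddCommGroup V] [NormedSpace ℝ V] {r : WithTop ℕ∞}

theorem twoForm_swap (η : E [⋀^Fin 2]→L[ℝ] ℝ) (u v : E) : η ![u, v] = -η ![v, u] := by
  have h := η.map_swap ![v, u] (i := 0) (j := 1) (by decide)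
  refine Eq.trans ?_ h
  change η ![u, v] = η _
  congr 1
  ext i
  fin_cases i <;> rfl

theorem twoForm_add_left (η : E [⋀^Fin 2]→L[ℝ] ℝ) (u u' v : E) :
    η ![u + u', v] = η ![u, v] + η ![u', v] :=
  η.vecCons_add ![v] u u'

theorem twoForm_smul_left (η : E [⋀^Fin 2]→L[ℝ] ℝ) (c : ℝ) (u v : E) :
    η ![c • u, v] = c * η ![u, v] :=
  η.vecCons_smul ![v] c u

theorem twoForm_add_right (η : E [⋀^Fin 2]→L[ℝ] ℝ) (u v v' : E) :
    η ![u, v + v'] = η ![u, v] + η ![u, v'] := by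
  rw [twoForm_swap, twoForm_add_left, twoForm_swap η v, twoForm_swap η v']
  ring

theorem twoForm_smul_right (η : E [⋀^Fin 2]→L[ℝ] ℝ) (c : ℝ) (u v : E) :
    η ![u, c • v] = c * η ![u, v] := by
  rw [twoForm_swap, twoForm_smul_left, twoForm_swap η v]
  ring

theorem twoForm_ext {η ζ : E [⋀^Fin 2]→L[ℝ] ℝ} (h : ∀ u v, η ![u, v] = ζ ![u, v]) : η = ζ := by
  ext v
  have hv : v = ![v 0, v 1] := by ext i; fin_cases i <;> rfl
  rw [hv]
  exact h _ _

theorem twoForm_comp_apply (η : E [⋀^Fin 2]→L[ℝ] ℝ) (A : V →L[ℝ] E) (u v : V) :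
    η.compContinuousLinearMap A ![u, v] = η ![A u, A v] := by
  rw [ContinuousAlternatingMap.compContinuousLinearMap_apply]
  congr 1
  ext i
  fin_cases i <;> rfl

/-- Evaluation of a two-form at a pair of vectors, as a continuous linear functional. -/
noncomputable def twoFormEval (u v : E) : (E [⋀^Fin 2]→L[ℝ] ℝ) →L[ℝ] ℝ :=
  ContinuousAlternatingMap.apply ℝ E ℝ ![u, v]

@[simp]
theorem twoFormEval_apply (u v : E) (η : E [⋀^Fin 2]→L[ℝ] ℝ) : twoFormEval u v η = η ![u, v] :=
  rfl

/-- A two-form as a bilinear form. -/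
noncomputable def toBilin : (E [⋀^Fin 2]→L[ℝ] ℝ) →L[ℝ] E →L[ℝ] E →L[ℝ] ℝ :=
  (ContinuousLinearMap.compL ℝ E (E [⋀^Fin 1]→L[ℝ] ℝ) (E →L[ℝ] ℝ)
    (ContinuousAlternatingMap.ofSubsingletonLIE (𝕜 := ℝ) (E := E) (F := ℝ)
      (0 : Fin 1)).symm.toContinuousLinearEquiv.toContinuousLinearMap) ∘L
    (ContinuousAlternatingMap.curryLeftLI (𝕜 := ℝ) (E := E) (F := ℝ)
      (n := 1)).toContinuousLinearMap

theorem toBilin_apply (η : E [⋀^Fin 2]→L[ℝ] ℝ) (u v : E) : toBilin η u v = η ![u, v] := by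
  change η (Matrix.vecCons u (fun _ => v)) = η ![u, v]
  congr 2
  ext i : 1
  fin_cases i
  rfl

/-- The antisymmetric part of a bilinear form, as a two-form. -/
noncomputable def antisymm : (E →L[ℝ] E →L[ℝ] ℝ) →L[ℝ] (E [⋀^Fin 2]→L[ℝ] ℝ) :=
  (2⁻¹ : ℝ) • (ContinuousAlternatingMap.alternatizeUncurryFinCLM ℝ E ℝ ∘L
    ContinuousLinearMap.compL ℝ E (E →L[ℝ] ℝ) (E [⋀^Fin 1]→L[ℝ] ℝ)
      (ContinuousAlternatingMap.ofSubsingletonLIE (𝕜 := ℝ) (E := E) (F := ℝ)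
        (0 : Fin 1)).toContinuousLinearEquiv.toContinuousLinearMap)

theorem antisymm_apply (B : E →L[ℝ] E →L[ℝ] ℝ) (u v : E) :
    antisymm B ![u, v] = 2⁻¹ * (B u v - B v u) := by
  simp [antisymm, ContinuousAlternatingMap.alternatizeUncurryFin_apply, Fin.sum_univ_two,
    Fin.removeNth, sub_eq_add_neg]

theorem contDiffAt_pullback {X : Type*} [NormedAddCommGroup X] [NormedSpace ℝ X] {x : X}
    {η : X → E [⋀^Fin 2]→L[ℝ] ℝ} {A : X → V →L[ℝ] E} (hη : ContDiffAt ℝ r η x)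
    (hA : ContDiffAt ℝ r A x) :
    ContDiffAt ℝ r (fun y => (η y).compContinuousLinearMap (A y)) x := by
  have h : (fun y => (η y).compContinuousLinearMap (A y)) = fun y =>
      -antisymm ((ContinuousLinearMap.flipₗᵢ ℝ V E ℝ ((toBilin (η y)).comp (A y))).comp (A y)) := by
    funext y
    refine twoForm_ext fun u v => ?_
    rw [ContinuousAlternatingMap.neg_apply, antisymm_apply, twoForm_comp_apply]
    simp only [ContinuousLinearMap.comp_apply, ContinuousLinearMap.coe_flipₗᵢ,
      ContinuousLinearMap.flip_apply, toBilin_apply]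
    rw [twoForm_swap (η y) (A y v)]
    ring
  rw [h]
  have h0 : ContDiffAt ℝ r (fun y => toBilin (η y)) x :=
    ContDiffAt.comp x (g := fun ζ => toBilin ζ)
      (show ContDiff ℝ r (toBilin (E := E)) from ContinuousLinearMap.contDiff _).contDiffAt hη
  have h1 : ContDiffAt ℝ r (fun y => (toBilin (η y)).comp (A y)) x := h0.clm_comp hA
  exact ((antisymm (E := V)).contDiff.contDiffAt.comp x
    (((ContinuousLinearMap.flipₗᵢ ℝ V E ℝ).contDiff.contDiffAt.comp x h1).clm_comp hA)).neg

theorem extDeriv_twoForm_apply {η : E → E [⋀^Fin 2]→L[ℝ] ℝ} {x : E}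
    (h : DifferentiableAt ℝ η x) (a b c : E) :
    extDeriv η x ![a, b, c] = fderiv ℝ (fun y => η y ![b, c]) x a
      - fderiv ℝ (fun y => η y ![a, c]) x b + fderiv ℝ (fun y => η y ![a, b]) x c := by
  have h0 : (0 : Fin 3).removeNth ![a, b, c] = ![b, c] := by
    ext i; fin_cases i <;> rfl
  have h1 : (1 : Fin 3).removeNth ![a, b, c] = ![a, c] := by
    ext i; fin_cases i <;> rfl
  have h2 : (2 : Fin 3).removeNth ![a, b, c] = ![a, b] := by
    ext i; fin_cases i <;> rfl
  rw [extDeriv_apply h, Fin.sum_univ_three, h0, h1, h2]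
  simp
  ring

theorem fderiv_twoForm_apply {η : E → E [⋀^Fin 2]→L[ℝ] ℝ} {x : E}
    (hη : DifferentiableAt ℝ η x) (u v : E) :
    fderiv ℝ (fun y => η y ![u, v]) x = (twoFormEval u v).comp (fderiv ℝ η x) :=
  ((twoFormEval u v).hasFDerivAt.comp x hη.hasFDerivAt).fderiv

/-- Cartan's formula for a constant vector field `e` whose contraction with the closed form `η`
is constant: the coefficients of `η` are constant along `e`. -/
theorem fderiv_twoForm_eq_zero {η : E → E [⋀^Fin 2]→L[ℝ] ℝ} {x e : E}
    (hη : DifferentiableAt ℝ η x) (hd : extDeriv η x = 0) {ℓ : E → ℝ}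
    (he : ∀ᶠ y in 𝓝 x, ∀ u, η y ![e, u] = ℓ u) : fderiv ℝ η x e = 0 := by
  have hconst : ∀ w, fderiv ℝ (fun y => η y ![e, w]) x = 0 := by
    intro w
    have : (fun y => η y ![e, w]) =ᶠ[𝓝 x] fun _ => ℓ w := he.mono fun y hy => hy w
    rw [this.fderiv_eq]
    simp
  refine twoForm_ext fun u v => ?_
  have h := extDeriv_twoForm_apply hη e u v
  rw [hd, hconst, hconst, fderiv_twoForm_apply hη] at h
  simpa using h.symm

end Forms

section Hamiltonian

variable {n : ℕ} {r : WithTop ℕ∞} {Ω : TwoForm n} {f : PhaseSpace n → ℝ}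

/-- The contraction `v ↦ v ⌟ Ω` of a nondegenerate two-form, as an isomorphism. -/
theorem exists_equiv_eq_flat {Ω : PhaseSpace n [⋀^Fin 2]→L[ℝ] ℝ}
    (h : ∀ v : PhaseSpace n, (∀ u : PhaseSpace n, Ω ![v, u] = 0) → v = 0) :
    ∃ e : PhaseSpace n ≃L[ℝ] (PhaseSpace n →L[ℝ] ℝ),
      (e : PhaseSpace n →L[ℝ] (PhaseSpace n →L[ℝ] ℝ)) = flat Ω := by
  have hinj : Function.Injective (flat Ω : PhaseSpace n →ₗ[ℝ] (PhaseSpace n →L[ℝ] ℝ)) := by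
    refine (injective_iff_map_eq_zero _).2 fun v hv => h v fun u => ?_
    rw [← flat_apply]
    exact DFunLike.congr_fun hv u
  have hdim : Module.finrank ℝ (PhaseSpace n) = Module.finrank ℝ (PhaseSpace n →L[ℝ] ℝ) := by
    rw [← (LinearMap.toContinuousLinearMap :
      (PhaseSpace n →ₗ[ℝ] ℝ) ≃ₗ[ℝ] (PhaseSpace n →L[ℝ] ℝ)).finrank_eq]
    exact Subspace.dual_finrank_eq.symm
  exact ⟨(LinearEquiv.ofInjectiveOfFinrankEq _ hinj hdim).toContinuousLinearEquiv,
    ContinuousLinearMap.ext fun v => rfl⟩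

theorem smoothNear_hamiltonianField (hr : r = ∞ ∨ r = ω) (hΩ : IsSymplectic r Ω)
    (hf : SmoothNear r f 0) : SmoothNear r (hamiltonianField Ω f) 0 := by
  have hflat : ContDiff ℝ r (flat : (PhaseSpace n [⋀^Fin 2]→L[ℝ] ℝ) → _) :=
    show ContDiff ℝ r (toBilin (E := PhaseSpace n)) from ContinuousLinearMap.contDiff _
  filter_upwards [isGerm_iff_smoothNear.1 hΩ.isGerm, hΩ.nondegenerate, hf.fderiv_right hr]
    with p hp hnd hdf
  obtain ⟨e, he⟩ := exists_equiv_eq_flat hnd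
  have h1 : ContDiffAt ℝ r (fun q => (flat (Ω q)).inverse) p := by
    have hinv := contDiffAt_map_inverse (n := r) e
    rw [he] at hinv
    exact ContDiffAt.comp p hinv (hflat.contDiffAt.comp p hp)
  exact h1.clm_apply hdf

end Hamiltonian

/-! ### Coordinates adapted to a pair of functions -/

section Flows

variable {E F : Type*} [NormedAddCommGroup E] [NormedSpace ℝ E]
  [NormedAddCommGroup F] [NormedSpace ℝ F] {r : WithTop ℕ∞}

/-- `φ` is a local flow of class `C^r` of the vector field `Z` near the origin. -/
structure IsLocalFlow (r : WithTop ℕ∞) (Z : E → E) (φ : ℝ × E → E) : Prop where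
  smoothNear : SmoothNear r φ 0
  zero_time : ∀ᶠ p in 𝓝 (0 : E), φ (0, p) = p
  hasDerivAt : ∀ᶠ q in 𝓝 (0 : ℝ × E), HasDerivAt (fun s => φ (s, q.2)) (Z (φ q)) q.1

theorem IsLocalFlow.map_zero {Z : E → E} {φ : ℝ × E → E} (hφ : IsLocalFlow r Z φ) : φ 0 = 0 :=
  hφ.zero_time.self_of_nhds

theorem IsLocalFlow.tendsto {Z : E → E} {φ : ℝ × E → E} (hφ : IsLocalFlow r Z φ) :
    Tendsto φ (𝓝 0) (𝓝 0) := by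
  have h := hφ.smoothNear.continuousAt.tendsto
  rwa [hφ.map_zero] at h

theorem eventually_snd {E : Type*} [NormedAddCommGroup E] {P : E → Prop}
    (h : ∀ᶠ p in 𝓝 (0 : E), P p) : ∀ᶠ q in 𝓝 (0 : ℝ × E), P q.2 :=
  (continuous_snd.tendsto' (0 : ℝ × E) 0 rfl).eventually h

theorem eventually_zero_prod {E : Type*} [NormedAddCommGroup E] {P : ℝ × E → Prop}
    (h : ∀ᶠ q in 𝓝 (0 : ℝ × E), P q) : ∀ᶠ p in 𝓝 (0 : E), P (0, p) :=
  (Continuous.tendsto' (f := fun p : E => ((0 : ℝ), p)) (by fun_prop) 0 0 rfl).eventually h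

/-- A function whose derivative along `Z` is the constant `c` grows linearly along the flow. -/
theorem IsLocalFlow.eventually_apply_eq {Z : E → E} {φ : ℝ × E → E} (hφ : IsLocalFlow r Z φ)
    (hr : r ≠ 0) {g : E → ℝ} (hg : SmoothNear r g 0) {c : ℝ}
    (hc : ∀ᶠ p in 𝓝 (0 : E), fderiv ℝ g p (Z p) = c) :
    ∀ᶠ q in 𝓝 (0 : ℝ × E), g (φ q) = g q.2 + c * q.1 := by
  have h : ∀ᶠ q in 𝓝 (0 : ℝ × E),
      HasDerivAt (fun s => g (φ (s, q.2)) - c * s) 0 q.1 := by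
    filter_upwards [hφ.hasDerivAt, hφ.tendsto.eventually hc,
      hφ.tendsto.eventually (hg.eventually_differentiableAt hr)] with q h1 h2 h3
    have h4 := (HasFDerivAt.comp_hasDerivAt q.1 (l := g) (f := fun s => φ (s, q.2))
      h3.hasFDerivAt h1).sub ((hasDerivAt_id q.1).const_mul c)
    rw [h2, mul_one, sub_self] at h4
    exact h4
  filter_upwards [eventually_eq_of_hasDerivAt_zero (k := fun q : ℝ × E => g (φ q) - c * q.1) h,
    eventually_snd hφ.zero_time] with q hq h0
  simp only [h0, mul_zero, sub_zero] at hq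
  linarith

theorem fderiv_apply_eq_of_hasDerivAt {G : E → F} {γ : ℝ → E} {s : ℝ} {e : E} {v : F}
    (hG : DifferentiableAt ℝ G (γ s)) (hγ : HasDerivAt γ e s)
    (h : HasDerivAt (fun t => G (γ t)) v s) : fderiv ℝ G (γ s) e = v :=
  (hG.hasFDerivAt.comp_hasDerivAt s hγ).unique h

/-- If `k` vanishes on `{s = 0}` and `∂k/∂s ≠ 0`, then near the origin `k` vanishes only there. -/
theorem eventually_eq_zero_iff {k : ℝ × E → ℝ} (hk : SmoothNear r k 0) (hr : r ≠ 0)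
    (h0 : ∀ᶠ p in 𝓝 (0 : E), k (0, p) = 0) (h1 : fderiv ℝ k 0 (1, 0) ≠ 0) :
    ∀ᶠ q in 𝓝 (0 : ℝ × E), k q = 0 ↔ q.1 = 0 := by
  set a := fderiv ℝ k 0 (1, 0) with ha
  have hcont : ContinuousAt (fun q => fderiv ℝ k q (1, 0)) 0 :=
    (hk.self.continuousAt_fderiv hr).clm_apply continuousAt_const
  have hclose : ∀ᶠ q in 𝓝 (0 : ℝ × E), ‖fderiv ℝ k q (1, 0) - a‖ ≤ ‖a‖ / 2 := by
    have h2 : ContinuousAt (fun q => ‖fderiv ℝ k q (1, 0) - a‖) 0 :=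
      (hcont.sub continuousAt_const).norm
    refine (h2.eventually_lt continuousAt_const ?_).mono fun _ h => h.le
    rw [← ha, sub_self, norm_zero]
    positivity
  obtain ⟨δ, hδ, hb⟩ := Metric.eventually_nhds_iff_ball.1
    (hclose.and (hk.eventually_differentiableAt hr))
  filter_upwards [Metric.ball_mem_nhds 0 hδ, eventually_snd h0] with q hq hq0
  have hmem : ∀ s ∈ Metric.ball (0 : ℝ) δ, (s, q.2) ∈ Metric.ball (0 : ℝ × E) δ := by
    intro s hs
    simp only [mem_ball_zero_iff, Prod.norm_def, max_lt_iff] at hq hs ⊢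
    exact ⟨hs, hq.2⟩
  have hq1 : q.1 ∈ Metric.ball (0 : ℝ) δ := by
    simp only [mem_ball_zero_iff, Prod.norm_def, max_lt_iff] at hq ⊢
    exact hq.1
  have key := (convex_ball (0 : ℝ) δ).norm_image_sub_le_of_norm_hasDerivWithin_le
    (f := fun s => k (s, q.2) - a * s) (f' := fun s => fderiv ℝ k (s, q.2) (1, 0) - a)
    (C := ‖a‖ / 2) (fun s hs => by
      have h2 := HasFDerivAt.comp_hasDerivAt s (f := fun s => (s, q.2))
        (hb _ (hmem s hs)).2.hasFDerivAt ((hasDerivAt_id s).prodMk (hasDerivAt_const s q.2))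
      have h3 := h2.sub ((hasDerivAt_id s).const_mul a)
      rw [mul_one] at h3
      exact h3.hasDerivWithinAt)
    (fun s hs => (hb _ (hmem s hs)).1) (Metric.mem_ball_self hδ) hq1
  simp only [hq0, mul_zero, sub_zero] at key
  constructor
  · intro hkq
    rw [show k (q.1, q.2) = 0 from hkq, zero_sub, norm_neg, norm_mul] at key
    have ha0 : 0 < ‖a‖ := norm_pos_iff.2 h1
    by_contra hne
    have : 0 < ‖q.1‖ := norm_pos_iff.2 hne
    nlinarith [mul_pos ha0 this]
  · intro h
    rw [← hq0, ← h]

end Flows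

section Slice

variable {m : ℕ} {r : WithTop ℕ∞}

theorem finrank_phaseSpace (m : ℕ) : Module.finrank ℝ (PhaseSpace m) = 2 * m := by
  simp [PhaseSpace, two_mul]

/-- If `dh` and `df` are linearly independent at the origin, then `{h = f = 0}` is there the
image of a section `ι` of a linear map onto `PhaseSpace m`. -/
theorem exists_slice (hr : r ≠ 0) {f h : PhaseSpace (m + 1) → ℝ} (hf : SmoothNear r f 0)
    (hh : SmoothNear r h 0) (hf0 : f 0 = 0) (hh0 : h 0 = 0) {a b : PhaseSpace (m + 1)}
    (hfa : fderiv ℝ f 0 a = 0) (hha : fderiv ℝ h 0 a ≠ 0) (hfb : fderiv ℝ f 0 b ≠ 0) :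
    ∃ (ι : PhaseSpace m → PhaseSpace (m + 1)) (L : PhaseSpace (m + 1) →L[ℝ] PhaseSpace m),
      SmoothNear r ι 0 ∧ ι 0 = 0 ∧
      ∀ᶠ z in 𝓝 (0 : PhaseSpace m), h (ι z) = 0 ∧ f (ι z) = 0 ∧ L (ι z) = z := by
  let A : PhaseSpace (m + 1) →ₗ[ℝ] ℝ × ℝ :=
    ((fderiv ℝ h 0).prod (fderiv ℝ f 0) : PhaseSpace (m + 1) →L[ℝ] ℝ × ℝ)
  have hA : Function.Surjective A := by
    rintro ⟨s, t⟩
    refine ⟨((s - t / fderiv ℝ f 0 b * fderiv ℝ h 0 b) / fderiv ℝ h 0 a) • a +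
      (t / fderiv ℝ f 0 b) • b, ?_⟩
    refine Prod.ext ?_ ?_
    · change fderiv ℝ h 0 _ = s
      simp only [map_add, map_smul, smul_eq_mul]
      field_simp
      ring
    · change fderiv ℝ f 0 _ = t
      simp only [map_add, map_smul, smul_eq_mul, hfa]
      field_simp
      ring
  have hker : Module.finrank ℝ (LinearMap.ker A) = Module.finrank ℝ (PhaseSpace m) := by
    have h1 := LinearMap.finrank_range_add_finrank_ker A
    rw [LinearMap.range_eq_top.2 hA, finrank_top, finrank_phaseSpace] at h1
    rw [finrank_phaseSpace]
    simp at h1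
    omega
  let e := LinearEquiv.ofFinrankEq _ _ hker
  obtain ⟨P, hP⟩ := (LinearMap.ker A).subtype.exists_leftInverse_of_injective
    (Submodule.ker_subtype _)
  let L : PhaseSpace (m + 1) →L[ℝ] PhaseSpace m :=
    LinearMap.toContinuousLinearMap (e.toLinearMap ∘ₗ P)
  let K' : PhaseSpace (m + 1) →L[ℝ] ℝ × ℝ × PhaseSpace m :=
    (fderiv ℝ h 0).prod ((fderiv ℝ f 0).prod L)
  have hinj : Function.Injective (K' : PhaseSpace (m + 1) →ₗ[ℝ] ℝ × ℝ × PhaseSpace m) := by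
    refine (injective_iff_map_eq_zero _).2 fun v hv => ?_
    have h1 : fderiv ℝ h 0 v = 0 := congrArg Prod.fst hv
    have h2 : fderiv ℝ f 0 v = 0 := congrArg (fun z => z.2.1) hv
    have h3 : e (P v) = 0 := congrArg (fun z => z.2.2) hv
    have hvk : v ∈ LinearMap.ker A := Prod.ext h1 h2
    have h4 : P v = ⟨v, hvk⟩ := LinearMap.congr_fun hP ⟨v, hvk⟩
    rw [e.map_eq_zero_iff, h4] at h3
    exact congrArg Subtype.val h3
  have hdim : Module.finrank ℝ (PhaseSpace (m + 1)) =
      Module.finrank ℝ (ℝ × ℝ × PhaseSpace m) := by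
    rw [finrank_phaseSpace, Module.finrank_prod, Module.finrank_prod, finrank_phaseSpace,
      Module.finrank_self]
    ring
  let eK : PhaseSpace (m + 1) ≃L[ℝ] ℝ × ℝ × PhaseSpace m :=
    (LinearEquiv.ofInjectiveOfFinrankEq _ hinj hdim).toContinuousLinearEquiv
  let K : PhaseSpace (m + 1) → ℝ × ℝ × PhaseSpace m := fun p => (h p, f p, L p)
  have hK : SmoothNear r K 0 := hh.prodMk (hf.prodMk (smoothNear_of_contDiff L.contDiff _))
  have hK' : HasFDerivAt K (eK : PhaseSpace (m + 1) →L[ℝ] ℝ × ℝ × PhaseSpace m) 0 :=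
    (hh.self.differentiableAt hr).hasFDerivAt.prodMk
      ((hf.self.differentiableAt hr).hasFDerivAt.prodMk L.hasFDerivAt)
  obtain ⟨Θ, hΘ, h0s, -, hΘs⟩ := hK.exists_openPartialHomeomorph hr hK'
  have hΘ0 : Θ 0 = 0 := by simp [hΘ, K, hf0, hh0]
  have h0t : (0 : ℝ × ℝ × PhaseSpace m) ∈ Θ.target := hΘ0 ▸ Θ.map_source h0s
  have hincl : Tendsto (fun z : PhaseSpace m => ((0 : ℝ), (0 : ℝ), z)) (𝓝 0) (𝓝 0) :=
    Continuous.tendsto' (by fun_prop) _ _ rfl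
  have hsymm : SmoothNear r Θ.symm 0 := by
    filter_upwards [Θ.open_target.mem_nhds h0t] with q hq
    exact hΘs.contDiffAt (Θ.open_target.mem_nhds hq)
  refine ⟨fun z => Θ.symm (0, 0, z), L,
    hsymm.comp_of_eq (smoothNear_of_contDiff (by fun_prop) _) rfl, ?_, ?_⟩
  · change Θ.symm 0 = 0
    conv_lhs => rw [← hΘ0]
    exact Θ.left_inv h0s
  · filter_upwards [hincl.eventually (Θ.open_target.mem_nhds h0t)] with z hz
    have h1 := Θ.right_inv hz
    rw [hΘ] at h1
    exact ⟨congrArg Prod.fst h1, congrArg (fun z => z.2.1) h1, congrArg (fun z => z.2.2) h1⟩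

end Slice

section Straightening

variable {m : ℕ} {r : WithTop ℕ∞}

/-- The vector `∂/∂x₁` of `ℝ × ℝ × PhaseSpace m`. -/
abbrev vecX (m : ℕ) : ℝ × ℝ × PhaseSpace m := (1, 0, 0)

/-- The vector `∂/∂y₁` of `ℝ × ℝ × PhaseSpace m`. -/
abbrev vecY (m : ℕ) : ℝ × ℝ × PhaseSpace m := (0, 1, 0)

/-- The inclusion of `PhaseSpace m` as the last factor of `ℝ × ℝ × PhaseSpace m`. -/
def inclLast (m : ℕ) : PhaseSpace m →L[ℝ] ℝ × ℝ × PhaseSpace m :=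
  ContinuousLinearMap.inr ℝ ℝ (ℝ × PhaseSpace m) ∘L ContinuousLinearMap.inr ℝ ℝ (PhaseSpace m)

@[simp]
theorem inclLast_apply (z : PhaseSpace m) : inclLast m z = (0, 0, z) := rfl

/-- A parametrisation `G` of a neighbourhood of the origin, with coordinates `(x, (y, z))`, in
which the Hamiltonian field of `f` is `∂/∂x`, the field `c • Z_h` is `∂/∂y` along `{x = 0}`,
the function `f` is `y`, and the hypersurface `{h = 0}` is `{x = 0}`. -/
structure IsAdapted (r : WithTop ℕ∞) (Ω : TwoForm (m + 1)) (f h c : PhaseSpace (m + 1) → ℝ)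
    (G : ℝ × ℝ × PhaseSpace m → PhaseSpace (m + 1)) : Prop where
  smoothNear : SmoothNear r G 0
  map_zero : G 0 = 0
  exists_equiv : ∃ e : (ℝ × ℝ × PhaseSpace m) ≃L[ℝ] PhaseSpace (m + 1),
    HasFDerivAt G (e : (ℝ × ℝ × PhaseSpace m) →L[ℝ] PhaseSpace (m + 1)) 0
  apply_fun : ∀ᶠ q in 𝓝 (0 : ℝ × ℝ × PhaseSpace m), f (G q) = q.2.1
  apply_eq_zero : ∀ᶠ q in 𝓝 (0 : ℝ × PhaseSpace m), h (G (0, q)) = 0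
  apply_eq_zero_iff : ∀ᶠ q in 𝓝 (0 : ℝ × ℝ × PhaseSpace m), h (G q) = 0 ↔ q.1 = 0
  fderiv_vecX : ∀ᶠ q in 𝓝 (0 : ℝ × ℝ × PhaseSpace m),
    fderiv ℝ G q (vecX m) = hamiltonianField Ω f (G q)
  fderiv_vecY : ∀ᶠ q in 𝓝 (0 : ℝ × PhaseSpace m),
    fderiv ℝ G (0, q) (vecY m) = c (G (0, q)) • hamiltonianField Ω h (G (0, q))

theorem IsAdapted.tendsto {Ω : TwoForm (m + 1)} {f h c : PhaseSpace (m + 1) → ℝ}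
    {G : ℝ × ℝ × PhaseSpace m → PhaseSpace (m + 1)} (hG : IsAdapted r Ω f h c G) :
    Tendsto G (𝓝 0) (𝓝 0) := by
  have h := hG.smoothNear.continuousAt.tendsto
  rwa [hG.map_zero] at h

theorem fderiv_hamiltonianField_swap {n : ℕ} {Ω : TwoForm n} {f h : PhaseSpace n → ℝ}
    {p : PhaseSpace n}
    (hp : ∀ v : PhaseSpace n, (∀ u : PhaseSpace n, Ω p ![v, u] = 0) → v = 0) :
    fderiv ℝ f p (hamiltonianField Ω h p) = -fderiv ℝ h p (hamiltonianField Ω f p) := by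
  rw [← apply_hamiltonianField Ω f p hp, ← apply_hamiltonianField Ω h p hp, twoForm_swap]

theorem fderiv_hamiltonianField_self {n : ℕ} {Ω : TwoForm n} {f : PhaseSpace n → ℝ}
    {p : PhaseSpace n}
    (hp : ∀ v : PhaseSpace n, (∀ u : PhaseSpace n, Ω p ![v, u] = 0) → v = 0) :
    fderiv ℝ f p (hamiltonianField Ω f p) = 0 := by
  have := fderiv_hamiltonianField_swap (f := f) (h := f) hp
  linarith

/-- The point with coordinates `(x, y, z)` is reached from the point `ι z` of the slice
`{f = h = 0}` by following the field `c • Z_h`, which is tangent to `{h = 0}` and along which `f`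
has derivative `1`, for the time `y`, and then `Z_f`, which preserves `f`, for the time `x`. -/
theorem exists_isAdapted (hr : r = ∞ ∨ r = ω) {Ω : TwoForm (m + 1)} (hΩ : IsSymplectic r Ω)
    {f h : PhaseSpace (m + 1) → ℝ} (hf : SmoothNear r f 0) (hh : SmoothNear r h 0)
    (hf0 : f 0 = 0) (hh0 : h 0 = 0) (hfh : poissonBracket Ω f h 0 ≠ 0) :
    ∃ c G, IsAdapted r Ω f h c G := by
  have hr0 := ne_zero_of_eq_infty_or_omega hr
  have hnd := hΩ.nondegenerate.self_of_nhds
  have hZ := smoothNear_hamiltonianField hr hΩ hf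
  have hY := smoothNear_hamiltonianField hr hΩ hh
  set Zf := hamiltonianField Ω f with hZf
  set Zh := hamiltonianField Ω h with hZh
  have hfZf0 : fderiv ℝ f 0 (Zf 0) = 0 := fderiv_hamiltonianField_self hnd
  have hhZf0 : fderiv ℝ h 0 (Zf 0) ≠ 0 := hfh
  have hfZh0 : fderiv ℝ f 0 (Zh 0) ≠ 0 := by
    rw [hZh, fderiv_hamiltonianField_swap hnd]
    exact neg_ne_zero.2 hhZf0
  obtain ⟨ι, L, hι, hι0, hιev⟩ := exists_slice hr0 hf hh hf0 hh0 hfZf0 hhZf0 hfZh0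
  -- the factor normalising the derivative of `f` along the field to `1`
  let b : PhaseSpace (m + 1) → ℝ := fun p => fderiv ℝ f p (Zh p)
  have hb : SmoothNear r b 0 := (hf.fderiv_right hr).clm_apply hY
  have hbne : ∀ᶠ p in 𝓝 (0 : PhaseSpace (m + 1)), b p ≠ 0 :=
    hb.continuousAt.eventually_ne hfZh0
  let X : PhaseSpace (m + 1) → PhaseSpace (m + 1) := fun p => (b p)⁻¹ • Zh p
  have hX : SmoothNear r X 0 := by
    filter_upwards [hb, hbne, hY] with p h1 h2 h3
    exact (h1.inv h2).smul h3
  have hfX : ∀ᶠ p in 𝓝 (0 : PhaseSpace (m + 1)), fderiv ℝ f p (X p) = 1 := by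
    filter_upwards [hbne] with p hp
    rw [map_smul, smul_eq_mul]
    exact inv_mul_cancel₀ hp
  have hhX : ∀ᶠ p in 𝓝 (0 : PhaseSpace (m + 1)), fderiv ℝ h p (X p) = 0 := by
    filter_upwards [hΩ.nondegenerate] with p hp
    rw [map_smul, fderiv_hamiltonianField_self hp, smul_zero]
  have hfZ : ∀ᶠ p in 𝓝 (0 : PhaseSpace (m + 1)), fderiv ℝ f p (Zf p) = 0 :=
    hΩ.nondegenerate.mono fun p hp => fderiv_hamiltonianField_self hp
  obtain ⟨φ, hφ1, hφ2, hφ3⟩ := hZ.exists_flow hr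
  obtain ⟨ψ, hψ1, hψ2, hψ3⟩ := hX.exists_flow hr
  have hφ : IsLocalFlow r Zf φ := ⟨hφ1, hφ2, hφ3⟩
  have hψ : IsLocalFlow r X ψ := ⟨hψ1, hψ2, hψ3⟩
  let B : ℝ × PhaseSpace m → PhaseSpace (m + 1) := fun q => ψ (q.1, ι q.2)
  let G : ℝ × ℝ × PhaseSpace m → PhaseSpace (m + 1) := fun q => φ (q.1, B q.2)
  have hιsnd : SmoothNear r (fun q : ℝ × PhaseSpace m => ι q.2) 0 :=
    hι.comp_of_eq (smoothNear_of_contDiff contDiff_snd _) rfl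
  have hin1 : SmoothNear r (fun q : ℝ × PhaseSpace m => (q.1, ι q.2)) 0 :=
    (smoothNear_of_contDiff contDiff_fst _).prodMk hιsnd
  have hB : SmoothNear r B 0 := hψ1.comp_of_eq hin1 (by simp [hι0])
  have hB0 : B 0 = 0 := by
    change ψ (0, ι 0) = 0
    rw [hι0]; exact hψ.map_zero
  have hBsnd : SmoothNear r (fun q : ℝ × ℝ × PhaseSpace m => B q.2) 0 :=
    hB.comp_of_eq (smoothNear_of_contDiff contDiff_snd _) rfl
  have hin2 : SmoothNear r (fun q : ℝ × ℝ × PhaseSpace m => (q.1, B q.2)) 0 :=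
    (smoothNear_of_contDiff contDiff_fst _).prodMk hBsnd
  have hG : SmoothNear r G 0 := hφ1.comp_of_eq hin2 (by simp [hB0])
  have hG0 : G 0 = 0 := by
    change φ (0, B 0) = 0
    rw [hB0]; exact hφ.map_zero
  have t1 : Tendsto (fun q : ℝ × PhaseSpace m => (q.1, ι q.2)) (𝓝 0) (𝓝 0) := by
    have := hin1.continuousAt.tendsto
    rwa [show ((0 : ℝ × PhaseSpace m).1, ι (0 : ℝ × PhaseSpace m).2) = 0 from
      Prod.ext rfl hι0] at this
  have tB : Tendsto B (𝓝 0) (𝓝 0) := by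
    have := hB.continuousAt.tendsto
    rwa [hB0] at this
  have t2 : Tendsto (fun q : ℝ × ℝ × PhaseSpace m => (q.1, B q.2)) (𝓝 0) (𝓝 0) := by
    have := hin2.continuousAt.tendsto
    rwa [show ((0 : ℝ × ℝ × PhaseSpace m).1, B (0 : ℝ × ℝ × PhaseSpace m).2) = 0 from
      Prod.ext rfl hB0] at this
  have tι : Tendsto ι (𝓝 0) (𝓝 0) := by
    have := hι.continuousAt.tendsto
    rwa [hι0] at this
  have hGx0 : ∀ᶠ q in 𝓝 (0 : ℝ × PhaseSpace m), G (0, q) = B q := tB.eventually hφ2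
  have hfB : ∀ᶠ q in 𝓝 (0 : ℝ × PhaseSpace m), f (B q) = q.1 := by
    filter_upwards [t1.eventually (hψ.eventually_apply_eq hr0 hf hfX), eventually_snd hιev]
      with q h1 h2
    rw [h2.2.1, zero_add, one_mul] at h1
    exact h1
  have hhB : ∀ᶠ q in 𝓝 (0 : ℝ × PhaseSpace m), h (B q) = 0 := by
    filter_upwards [t1.eventually (hψ.eventually_apply_eq hr0 hh hhX), eventually_snd hιev]
      with q h1 h2
    rw [h2.1, zero_add, zero_mul] at h1
    exact h1
  have hfG : ∀ᶠ q in 𝓝 (0 : ℝ × ℝ × PhaseSpace m), f (G q) = q.2.1 := by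
    filter_upwards [t2.eventually (hφ.eventually_apply_eq hr0 hf hfZ), eventually_snd hfB]
      with q h1 h2
    rw [h2, zero_mul, add_zero] at h1
    exact h1
  have hhG : ∀ᶠ q in 𝓝 (0 : ℝ × PhaseSpace m), h (G (0, q)) = 0 := by
    filter_upwards [hGx0, hhB] with q h1 h2
    rw [h1, h2]
  have hGx : ∀ᶠ q in 𝓝 (0 : ℝ × ℝ × PhaseSpace m), fderiv ℝ G q (vecX m) = Zf (G q) := by
    filter_upwards [t2.eventually hφ3, hG.eventually_differentiableAt hr0] with q h1 h2
    exact fderiv_apply_eq_of_hasDerivAt (γ := fun s => (s, q.2)) (s := q.1) h2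
      ((hasDerivAt_id q.1).prodMk (hasDerivAt_const q.1 q.2)) h1
  have hGy : ∀ᶠ q in 𝓝 (0 : ℝ × PhaseSpace m), fderiv ℝ G (0, q) (vecY m) = X (G (0, q)) := by
    filter_upwards [t1.eventually hψ3, eventually_zero_prod (hG.eventually_differentiableAt hr0),
      hGx0, hGx0.eventually_nhds] with q h1 h2 h3 h4
    refine fderiv_apply_eq_of_hasDerivAt (γ := fun s => (0, s, q.2)) (s := q.1) h2
      ((hasDerivAt_const q.1 _).prodMk ((hasDerivAt_id q.1).prodMk (hasDerivAt_const q.1 q.2))) ?_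
    rw [h3]
    refine h1.congr_of_eventuallyEq ?_
    have hc : Tendsto (fun s : ℝ => (s, q.2)) (𝓝 q.1) (𝓝 q) :=
      Continuous.tendsto' (by fun_prop) _ _ rfl
    exact hc.eventually h4
  have hhGs : SmoothNear r (fun q => h (G q)) 0 := hh.comp_of_eq hG hG0
  have hGd : HasFDerivAt G (fderiv ℝ G 0) 0 := (hG.self.differentiableAt hr0).hasFDerivAt
  have hfd : HasFDerivAt f (fderiv ℝ f 0) (G 0) := by
    rw [hG0]; exact (hf.self.differentiableAt hr0).hasFDerivAt
  have hhd : HasFDerivAt h (fderiv ℝ h 0) (G 0) := by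
    rw [hG0]; exact (hh.self.differentiableAt hr0).hasFDerivAt
  have hGx' : fderiv ℝ G 0 (vecX m) = Zf 0 := by
    have := hGx.self_of_nhds
    rwa [hG0] at this
  have hdf : ∀ u : ℝ × ℝ × PhaseSpace m, fderiv ℝ f 0 (fderiv ℝ G 0 u) = u.2.1 := by
    intro u
    have h1 := hfd.comp (0 : ℝ × ℝ × PhaseSpace m) hGd
    have h2 : HasFDerivAt (fun q : ℝ × ℝ × PhaseSpace m => q.2.1)
        (ContinuousLinearMap.fst ℝ ℝ (PhaseSpace m) ∘L
          ContinuousLinearMap.snd ℝ ℝ (ℝ × PhaseSpace m)) 0 :=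
      hasFDerivAt_fst.comp (0 : ℝ × ℝ × PhaseSpace m) hasFDerivAt_snd
    exact DFunLike.congr_fun (h1.unique (h2.congr_of_eventuallyEq hfG)) u
  have hdh : ∀ v : ℝ × PhaseSpace m, fderiv ℝ h 0 (fderiv ℝ G 0 (0, v)) = 0 := by
    intro v
    have h1 := (hhd.comp (0 : ℝ × ℝ × PhaseSpace m) hGd).comp (0 : ℝ × PhaseSpace m)
      (f := fun q => (0, q)) (hasFDerivAt_prodMk_right (0 : ℝ) (0 : ℝ × PhaseSpace m))
    have h2 : HasFDerivAt (fun _ : ℝ × PhaseSpace m => (0 : ℝ))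
        (0 : ℝ × PhaseSpace m →L[ℝ] ℝ) (0 : ℝ × PhaseSpace m) :=
      hasFDerivAt_const _ _
    exact DFunLike.congr_fun (h1.unique (h2.congr_of_eventuallyEq hhG)) v
  have hdL : ∀ z : PhaseSpace m, L (fderiv ℝ G 0 (inclLast m z)) = z := by
    intro z
    have h0 : HasFDerivAt (fun q => L (G q)) (L.comp (fderiv ℝ G 0))
        (inclLast m (0 : PhaseSpace m)) :=
      L.hasFDerivAt.comp (0 : ℝ × ℝ × PhaseSpace m) hGd
    have h1 := h0.comp (0 : PhaseSpace m) (inclLast m).hasFDerivAt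
    have h2 : HasFDerivAt (fun z : PhaseSpace m => z) (ContinuousLinearMap.id ℝ (PhaseSpace m))
      (0 : PhaseSpace m) := hasFDerivAt_id _
    refine DFunLike.congr_fun (h1.unique (h2.congr_of_eventuallyEq ?_)) z
    filter_upwards [hιev, tι.eventually hψ2, eventually_zero_prod hGx0] with z h3 h4 h5
    change L (G (0, 0, z)) = z
    rw [h5]
    change L (ψ (0, ι z)) = z
    rw [h4, h3.2.2]
  have hinj : Function.Injective
      (fderiv ℝ G 0 : (ℝ × ℝ × PhaseSpace m) →ₗ[ℝ] PhaseSpace (m + 1)) := by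
    refine (injective_iff_map_eq_zero _).2 fun u hu => ?_
    replace hu : fderiv ℝ G 0 u = 0 := hu
    have hy : u.2.1 = 0 := by rw [← hdf, hu, map_zero]
    have hsplit : u = u.1 • vecX m + (0, u.2) := by ext <;> simp
    have hx : u.1 = 0 := by
      have h1 : fderiv ℝ h 0 (fderiv ℝ G 0 u) = 0 := by rw [hu, map_zero]
      rw [hsplit, map_add, map_add, hdh, map_smul, map_smul, hGx', add_zero, smul_eq_mul] at h1
      exact (mul_eq_zero.1 h1).resolve_right hhZf0
    have hu' : u = inclLast m u.2.2 := Prod.ext hx (Prod.ext hy rfl)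
    have hz : u.2.2 = 0 := by rw [← hdL u.2.2, ← hu', hu, map_zero]
    exact Prod.ext hx (Prod.ext hy hz)
  have hdim : Module.finrank ℝ (ℝ × ℝ × PhaseSpace m) =
      Module.finrank ℝ (PhaseSpace (m + 1)) := by
    rw [finrank_phaseSpace, Module.finrank_prod, Module.finrank_prod, finrank_phaseSpace,
      Module.finrank_self]
    ring
  refine ⟨fun p => (b p)⁻¹, G, hG, hG0,
    ⟨(LinearEquiv.ofInjectiveOfFinrankEq _ hinj hdim).toContinuousLinearEquiv, hGd⟩,
    hfG, hhG, ?_, hGx, hGy⟩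
  refine eventually_eq_zero_iff hhGs hr0 hhG ?_
  have h1 : fderiv ℝ (fun q => h (G q)) 0 = (fderiv ℝ h 0).comp (fderiv ℝ G 0) :=
    (hhd.comp (0 : ℝ × ℝ × PhaseSpace m) hGd).fderiv
  rw [h1]
  change fderiv ℝ h 0 (fderiv ℝ G 0 (vecX m)) ≠ 0
  rwa [hGx']

end Straightening

/-! ### The symplectic form in adapted coordinates -/

section Reduction

variable {m : ℕ} {r : WithTop ℕ∞}

/-- The symplectic form on the slice `{x = y = 0}` of adapted coordinates. -/
noncomputable def reducedForm (Ω : TwoForm (m + 1))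
    (G : ℝ × ℝ × PhaseSpace m → PhaseSpace (m + 1)) : TwoForm m := fun z =>
  ((Ω (G (inclLast m z))).compContinuousLinearMap
    (fderiv ℝ G (inclLast m z))).compContinuousLinearMap (inclLast m)

variable {Ω : TwoForm (m + 1)} {f h c : PhaseSpace (m + 1) → ℝ}
  {G : ℝ × ℝ × PhaseSpace m → PhaseSpace (m + 1)}

theorem IsAdapted.smoothNear_pullback (hr : r = ∞ ∨ r = ω) (hΩ : IsSymplectic r Ω)
    (hG : IsAdapted r Ω f h c G) :
    SmoothNear r (fun q => (Ω (G q)).compContinuousLinearMap (fderiv ℝ G q)) 0 := by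
  filter_upwards [hG.smoothNear, hG.smoothNear.fderiv_right hr,
    hG.tendsto.eventually (isGerm_iff_smoothNear.1 hΩ.isGerm)] with q h1 h2 h3
  exact contDiffAt_pullback (ContDiffAt.comp q h3 h1) h2

theorem IsAdapted.eventually_extDeriv_pullback (hr : r = ∞ ∨ r = ω) (hΩ : IsSymplectic r Ω)
    (hG : IsAdapted r Ω f h c G) : ∀ᶠ q in 𝓝 0,
    extDeriv (fun q => (Ω (G q)).compContinuousLinearMap (fderiv ℝ G q)) q = 0 := by
  filter_upwards [hG.smoothNear, hG.tendsto.eventually hΩ.closed,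
    hG.tendsto.eventually ((isGerm_iff_smoothNear.1 hΩ.isGerm).eventually_differentiableAt
      (ne_zero_of_eq_infty_or_omega hr))] with q h1 h2 h3
  rw [extDeriv_pullback h3 h1 (by simpa using two_le_of_eq_infty_or_omega hr), h2]
  rfl

theorem IsAdapted.eventually_exists_equiv (hr : r = ∞ ∨ r = ω) (hG : IsAdapted r Ω f h c G) :
    ∀ᶠ q in 𝓝 (0 : ℝ × ℝ × PhaseSpace m),
      ∃ e : (ℝ × ℝ × PhaseSpace m) ≃L[ℝ] PhaseSpace (m + 1),
        (e : (ℝ × ℝ × PhaseSpace m) →L[ℝ] PhaseSpace (m + 1)) = fderiv ℝ G q := by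
  obtain ⟨e, he⟩ := hG.exists_equiv
  have hnhds := ContinuousLinearEquiv.nhds e
  rw [← he.fderiv] at hnhds
  exact (hG.smoothNear.self.continuousAt_fderiv (ne_zero_of_eq_infty_or_omega hr)).eventually hnhds

/-- In adapted coordinates the symplectic form is `dx ∧ dy + σ`, where `σ` is the pullback of a
two-form in the remaining coordinates. -/
theorem IsAdapted.eventually_pullback_eq (hr : r = ∞ ∨ r = ω) (hΩ : IsSymplectic r Ω)
    (hh : SmoothNear r h 0) (hG : IsAdapted r Ω f h c G) (hf : SmoothNear r f 0) :
    ∀ᶠ q in 𝓝 (0 : ℝ × ℝ × PhaseSpace m), ∀ u v,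
      (Ω (G q)).compContinuousLinearMap (fderiv ℝ G q) ![u, v] =
        u.1 * v.2.1 - u.2.1 * v.1 + reducedForm Ω G q.2.2 ![u.2.2, v.2.2] := by
  have hr0 := ne_zero_of_eq_infty_or_omega hr
  set η : ℝ × ℝ × PhaseSpace m → (ℝ × ℝ × PhaseSpace m) [⋀^Fin 2]→L[ℝ] ℝ :=
    fun q => (Ω (G q)).compContinuousLinearMap (fderiv ℝ G q) with hη
  have hηs : SmoothNear r η 0 := hG.smoothNear_pullback hr hΩ
  have hηd := hηs.eventually_differentiableAt hr0
  have hηc : ∀ᶠ q in 𝓝 0, extDeriv η q = 0 := hG.eventually_extDeriv_pullback hr hΩ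
  have hX : ∀ᶠ q in 𝓝 0, ∀ u, η q ![vecX m, u] = u.2.1 := by
    filter_upwards [hG.fderiv_vecX, hG.apply_fun.eventually_nhds,
      hG.tendsto.eventually hΩ.nondegenerate,
      hG.tendsto.eventually (hf.eventually_differentiableAt hr0),
      hG.smoothNear.eventually_differentiableAt hr0] with q h1 h2 h3 h4 h5 u
    have h6 : HasFDerivAt (fun q : ℝ × ℝ × PhaseSpace m => q.2.1)
        (ContinuousLinearMap.fst ℝ ℝ (PhaseSpace m) ∘L
          ContinuousLinearMap.snd ℝ ℝ (ℝ × PhaseSpace m)) q :=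
      hasFDerivAt_fst.comp q hasFDerivAt_snd
    have h7 := (h4.hasFDerivAt.comp q h5.hasFDerivAt).unique (h6.congr_of_eventuallyEq h2)
    rw [hη, twoForm_comp_apply, h1, apply_hamiltonianField _ _ _ h3]
    exact DFunLike.congr_fun h7 u
  -- `η` does not depend on `x`
  have hηx : ∀ᶠ q in 𝓝 (0 : ℝ × ℝ × PhaseSpace m), η q = η (0, q.2) := by
    refine eventually_eq_of_hasDerivAt_zero ?_
    filter_upwards [hηd, hηc, hX.eventually_nhds] with q h1 h2 h3
    have h4 := HasFDerivAt.comp_hasDerivAt q.1 (f := fun s => (s, q.2)) (l := η)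
      h1.hasFDerivAt ((hasDerivAt_id q.1).prodMk (hasDerivAt_const q.1 q.2))
    rwa [show fderiv ℝ η q (1, 0) = 0 from fderiv_twoForm_eq_zero h1 h2 h3] at h4
  have hY0 : ∀ᶠ q in 𝓝 (0 : ℝ × PhaseSpace m), ∀ u, η (0, q) ![vecY m, u] = -u.1 := by
    filter_upwards [hG.fderiv_vecY, hG.apply_eq_zero.eventually_nhds, eventually_zero_prod hX,
      eventually_zero_prod (hG.tendsto.eventually hΩ.nondegenerate),
      eventually_zero_prod (hG.tendsto.eventually (hh.eventually_differentiableAt hr0)),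
      eventually_zero_prod (hG.smoothNear.eventually_differentiableAt hr0)]
      with q h1 h2 h3 h4 h5 h6 u
    have hsplit : u = u.1 • vecX m + (0, u.2) := by ext <;> simp
    have h7 := (h5.hasFDerivAt.comp ((0 : ℝ), q) h6.hasFDerivAt).comp q
      (f := fun q => ((0 : ℝ), q)) (hasFDerivAt_prodMk_right (0 : ℝ) q)
    have h8 : HasFDerivAt (fun _ : ℝ × PhaseSpace m => (0 : ℝ))
        (0 : ℝ × PhaseSpace m →L[ℝ] ℝ) q := hasFDerivAt_const _ _
    have h9 : fderiv ℝ h (G (0, q)) (fderiv ℝ G (0, q) (0, u.2)) = 0 :=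
      DFunLike.congr_fun (h7.unique (h8.congr_of_eventuallyEq h2)) u.2
    have h10 : η (0, q) ![vecY m, (0, u.2)] = 0 := by
      rw [hη, twoForm_comp_apply, h1, twoForm_smul_left, apply_hamiltonianField _ _ _ h4, h9,
        mul_zero]
    conv_lhs => rw [hsplit]
    rw [twoForm_add_right, twoForm_smul_right, h10, twoForm_swap, h3]
    simp
  have hY : ∀ᶠ q in 𝓝 (0 : ℝ × ℝ × PhaseSpace m), ∀ u, η q ![vecY m, u] = -u.1 := by
    filter_upwards [hηx, eventually_snd hY0] with q h1 h2 u
    rw [h1, h2]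
  -- on `{x = 0}`, `η` does not depend on `y`
  have hηy : ∀ᶠ q in 𝓝 (0 : ℝ × PhaseSpace m), η (0, q) = η (0, 0, q.2) := by
    refine eventually_eq_of_hasDerivAt_zero (k := fun q => η (0, q)) ?_
    filter_upwards [eventually_zero_prod hηd, eventually_zero_prod hηc,
      eventually_zero_prod hY.eventually_nhds] with q h1 h2 h3
    have h4 := HasFDerivAt.comp_hasDerivAt q.1 (f := fun s => ((0 : ℝ), s, q.2)) (l := η)
      h1.hasFDerivAt ((hasDerivAt_const q.1 (0 : ℝ)).prodMk
        ((hasDerivAt_id q.1).prodMk (hasDerivAt_const q.1 q.2)))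
    rw [fderiv_twoForm_eq_zero h1 h2 h3] at h4
    exact h4
  filter_upwards [hηx, eventually_snd hηy, hX, hY] with q h1 h2 h3 h4 u v
  have hred : ∀ a b, reducedForm Ω G q.2.2 ![a, b] = η q ![inclLast m a, inclLast m b] := by
    intro a b
    rw [reducedForm, twoForm_comp_apply, h1, h2]
    rfl
  have hsplit : ∀ w : ℝ × ℝ × PhaseSpace m,
      w = w.1 • vecX m + (w.2.1 • vecY m + inclLast m w.2.2) := by
    intro w; ext <;> simp
  have hlast : ∀ w a, η q ![inclLast m a, w] = η q ![inclLast m a, inclLast m w.2.2] := by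
    intro w a
    conv_lhs => rw [hsplit w]
    rw [twoForm_add_right, twoForm_add_right, twoForm_smul_right, twoForm_smul_right,
      twoForm_swap _ _ (vecX m), twoForm_swap _ _ (vecY m), h3, h4]
    simp
  conv_lhs => rw [hsplit u]
  rw [twoForm_add_left, twoForm_add_left, twoForm_smul_left, twoForm_smul_left, h3, h4, hlast,
    hred]
  ring

theorem IsAdapted.isSymplectic_reducedForm (hr : r = ∞ ∨ r = ω) (hΩ : IsSymplectic r Ω)
    (hh : SmoothNear r h 0) (hG : IsAdapted r Ω f h c G) (hf : SmoothNear r f 0) :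
    IsSymplectic r (reducedForm Ω G) := by
  have hr0 := ne_zero_of_eq_infty_or_omega hr
  have hj : Tendsto (inclLast m) (𝓝 0) (𝓝 0) :=
    (inclLast m).continuous.tendsto' _ _ (inclLast m).map_zero
  have hs := hG.smoothNear_pullback hr hΩ
  refine ⟨isGerm_iff_smoothNear.2 ?_, ?_, ?_⟩
  · filter_upwards [hj.eventually hs] with z hz
    exact contDiffAt_pullback (ContDiffAt.comp z hz (inclLast m).contDiff.contDiffAt)
      contDiffAt_const
  · filter_upwards [hj.eventually (hG.eventually_extDeriv_pullback hr hΩ),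
      hj.eventually (hs.eventually_differentiableAt hr0)] with z h1 h2
    have h3 := extDeriv_pullback (f := inclLast m) (x := z) (r := r) h2
      (inclLast m).contDiff.contDiffAt (by simpa using two_le_of_eq_infty_or_omega hr)
    rw [h1] at h3
    simp only [ContinuousLinearMap.fderiv] at h3
    exact h3
  · filter_upwards [hj.eventually (hG.eventually_exists_equiv hr),
      hj.eventually (hG.tendsto.eventually hΩ.nondegenerate),
      hj.eventually (hG.eventually_pullback_eq hr hΩ hh hf)] with z h1 h2 h3 w hw
    obtain ⟨e, he⟩ := h1
    have h4 : ∀ v, Ω (G (inclLast m z)) ![e (inclLast m w), v] = 0 := by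
      intro v
      obtain ⟨v, rfl⟩ := e.surjective v
      have h5 := h3 (inclLast m w) v
      rw [twoForm_comp_apply, ← he] at h5
      refine h5.trans ?_
      simpa using hw v.2.2
    have h6 := h2 _ h4
    rw [e.map_eq_zero_iff] at h6
    exact congrArg (fun q => q.2.2) h6

end Reduction

/-! ### Normal forms -/

section NormalForm

variable {m : ℕ} {r : WithTop ℕ∞}

/-- The form `∑ dx_i ∧ dy_i`. -/
noncomputable def standardForm (m : ℕ) : PhaseSpace m [⋀^Fin 2]→L[ℝ] ℝ :=
  ∑ i : Fin m, wedge (dx i) (dy i)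

/-- `Ω` has a Darboux chart at the origin. -/
def HasDarbouxChart (r : WithTop ℕ∞) (Ω : TwoForm m) : Prop :=
  ∃ Φ : OpenPartialHomeomorph (PhaseSpace m) (PhaseSpace m),
    (0 : PhaseSpace m) ∈ Φ.source ∧ Φ 0 = 0 ∧
    ContDiffOn ℝ r Φ Φ.source ∧ ContDiffOn ℝ r Φ.symm Φ.target ∧
    ∀ᶠ p in 𝓝 (0 : PhaseSpace m),
      (standardForm m).compContinuousLinearMap (fderiv ℝ Φ p) = Ω p

theorem standardForm_apply (u v : PhaseSpace m) :
    standardForm m ![u, v] = ∑ i, (u.1 i * v.2 i - u.2 i * v.1 i) := by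
  rw [standardForm, ContinuousAlternatingMap.sum_apply]
  refine Finset.sum_congr rfl fun i _ => ?_
  rw [wedge_apply]
  simp [dx, dy]
  ring

/-- The splitting `(x₁, y₁, (x', y')) ↦ ((x₁, x'), (y₁, y'))`. -/
noncomputable def consEquiv (m : ℕ) : (ℝ × ℝ × PhaseSpace m) ≃L[ℝ] PhaseSpace (m + 1) :=
  LinearEquiv.toContinuousLinearEquiv
    { toFun := fun q => (Fin.cons q.1 q.2.2.1, Fin.cons q.2.1 q.2.2.2)
      invFun := fun p => (p.1 0, p.2 0, Fin.tail p.1, Fin.tail p.2)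
      map_add' := fun a b => by
        ext i <;> refine Fin.cases ?_ (fun j => ?_) i <;> simp
      map_smul' := fun t a => by
        ext i <;> refine Fin.cases ?_ (fun j => ?_) i <;> simp
      left_inv := fun q => by simp
      right_inv := fun p => by simp }

@[simp]
theorem consEquiv_apply (q : ℝ × ℝ × PhaseSpace m) :
    consEquiv m q = (Fin.cons q.1 q.2.2.1, Fin.cons q.2.1 q.2.2.2) := rfl

theorem standardForm_consEquiv (u v : ℝ × ℝ × PhaseSpace m) :
    standardForm (m + 1) ![consEquiv m u, consEquiv m v] =
      u.1 * v.2.1 - u.2.1 * v.1 + standardForm m ![u.2.2, v.2.2] := by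
  rw [standardForm_apply, standardForm_apply, Fin.sum_univ_succ]
  simp

/-- The normal form of a symplectic form, a hypersurface `{h = 0}` and a function `f` with
`{f, h} ≠ 0`, given Darboux charts in dimension two less: the chart is applied to the last
coordinates of an adapted parametrisation. -/
theorem exists_normalForm (hr : r = ∞ ∨ r = ω)
    (hD : ∀ σ : TwoForm m, IsSymplectic r σ → HasDarbouxChart r σ)
    {Ω : TwoForm (m + 1)} (hΩ : IsSymplectic r Ω)
    {f h : PhaseSpace (m + 1) → ℝ} (hf : SmoothNear r f 0) (hh : SmoothNear r h 0)
    (hf0 : f 0 = 0) (hh0 : h 0 = 0) (hfh : poissonBracket Ω f h 0 ≠ 0) :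
    ∃ Φ : OpenPartialHomeomorph (PhaseSpace (m + 1)) (PhaseSpace (m + 1)),
      (0 : PhaseSpace (m + 1)) ∈ Φ.source ∧ Φ 0 = 0 ∧
      ContDiffOn ℝ r Φ Φ.source ∧ ContDiffOn ℝ r Φ.symm Φ.target ∧
      (∀ᶠ p in 𝓝 (0 : PhaseSpace (m + 1)),
        (standardForm (m + 1)).compContinuousLinearMap (fderiv ℝ Φ p) = Ω p) ∧
      (∀ᶠ p in 𝓝 (0 : PhaseSpace (m + 1)), h p = 0 ↔ (Φ p).1 0 = 0) ∧
      ∀ᶠ p in 𝓝 (0 : PhaseSpace (m + 1)), (Φ p).2 0 = f p := by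
  have hr0 := ne_zero_of_eq_infty_or_omega hr
  obtain ⟨c, G, hG⟩ := exists_isAdapted hr hΩ hf hh hf0 hh0 hfh
  obtain ⟨Ψ, hΨ0, hΨz, hΨs, hΨt, hΨf⟩ := hD _ (hG.isSymplectic_reducedForm hr hΩ hh hf)
  obtain ⟨e, he⟩ := hG.exists_equiv
  obtain ⟨Γ, hΓ, hΓ0, hΓs, hΓt⟩ := hG.smoothNear.exists_openPartialHomeomorph hr0 he
  have hΓz : Γ 0 = 0 := by rw [hΓ, hG.map_zero]
  have hΓz' : Γ.symm 0 = 0 := by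
    conv_lhs => rw [← hΓz]
    exact Γ.left_inv hΓ0
  have hΓ0t : (0 : PhaseSpace (m + 1)) ∈ Γ.target := hΓz ▸ Γ.map_source hΓ0
  let M : OpenPartialHomeomorph (ℝ × ℝ × PhaseSpace m) (ℝ × ℝ × PhaseSpace m) :=
    (OpenPartialHomeomorph.refl ℝ).prod ((OpenPartialHomeomorph.refl ℝ).prod Ψ)
  have hMs : ContDiffOn ℝ r M M.source := by
    refine contDiffOn_fst.prodMk ((contDiff_fst.comp contDiff_snd).contDiffOn.prodMk ?_)
    exact hΨs.comp (contDiff_snd.comp contDiff_snd).contDiffOn fun q hq => hq.2.2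
  have hMt : ContDiffOn ℝ r M.symm M.target := by
    refine contDiffOn_fst.prodMk ((contDiff_fst.comp contDiff_snd).contDiffOn.prodMk ?_)
    exact hΨt.comp (contDiff_snd.comp contDiff_snd).contDiffOn fun q hq => hq.2.2
  have hM0 : (0 : ℝ × ℝ × PhaseSpace m) ∈ M.source := ⟨trivial, trivial, hΨ0⟩
  let A := (consEquiv m).toHomeomorph.toOpenPartialHomeomorph
  let Φ := (Γ.symm.trans M).trans A
  have hΦ : ∀ p, Φ p = consEquiv m (M (Γ.symm p)) := fun p => rfl
  have hΓsymm : Tendsto Γ.symm (𝓝 0) (𝓝 0) := by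
    have := (Γ.continuousAt_symm hΓ0t).tendsto
    rwa [hΓz'] at this
  have hΓinv : ∀ᶠ p in 𝓝 (0 : PhaseSpace (m + 1)), G (Γ.symm p) = p := by
    filter_upwards [Γ.open_target.mem_nhds hΓ0t] with p hp
    rw [← hΓ]
    exact Γ.right_inv hp
  refine ⟨Φ, ?_, ?_, ?_, ?_, ?_, ?_, ?_⟩
  · refine ⟨⟨hΓ0t, ?_⟩, trivial⟩
    change Γ.symm 0 ∈ M.source
    rwa [hΓz']
  · rw [hΦ, hΓz']
    change consEquiv m (0, 0, Ψ 0) = 0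
    rw [hΨz]
    exact map_zero _
  · exact (consEquiv m).contDiff.comp_contDiffOn
      (hMs.comp (hΓt.mono fun p hp => hp.1.1) fun p hp => hp.1.2)
  · refine (hΓs.comp (hMt.comp (consEquiv m).symm.contDiff.contDiffOn ?_) ?_)
    · intro p hp
      have := hp.2
      exact this.1
    · intro p hp
      have := hp.2
      exact this.2
  · have h := hΓsymm.eventually ((hG.eventually_pullback_eq hr hΩ hh hf).and
      ((hG.eventually_exists_equiv hr).and
        (((continuous_snd.comp continuous_snd).tendsto' (0 : ℝ × ℝ × PhaseSpace m) 0 rfl).eventually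
          hΨf)))
    filter_upwards [h, hΓinv, Γ.symm.open_source.mem_nhds hΓ0t,
      hΓsymm.eventually (M.open_source.mem_nhds hM0)] with p hp hinv hpt hpM
    obtain ⟨h1, ⟨e, he⟩, h3⟩ := hp
    set q := Γ.symm p with hq
    change (standardForm m).compContinuousLinearMap (fderiv ℝ Ψ q.2.2) =
      reducedForm Ω G q.2.2 at h3
    have hqs : q ∈ Γ.source := Γ.map_target hpt
    have hΨd : HasFDerivAt Ψ (fderiv ℝ Ψ q.2.2) q.2.2 :=
      ((hΨs.contDiffAt (Ψ.open_source.mem_nhds hpM.2.2)).differentiableAt hr0).hasFDerivAt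
    have hM' : HasFDerivAt M ((ContinuousLinearMap.fst ℝ ℝ (ℝ × PhaseSpace m)).prod
        ((ContinuousLinearMap.fst ℝ ℝ (PhaseSpace m) ∘L
          ContinuousLinearMap.snd ℝ ℝ (ℝ × PhaseSpace m)).prod
          (fderiv ℝ Ψ q.2.2 ∘L (ContinuousLinearMap.snd ℝ ℝ (PhaseSpace m) ∘L
            ContinuousLinearMap.snd ℝ ℝ (ℝ × PhaseSpace m))))) q :=
      hasFDerivAt_fst.prodMk ((hasFDerivAt_fst.comp q hasFDerivAt_snd).prodMk
        (hΨd.comp q (hasFDerivAt_snd.comp q hasFDerivAt_snd)))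
    have hΓd : HasFDerivAt Γ.symm (e.symm : PhaseSpace (m + 1) →L[ℝ] ℝ × ℝ × PhaseSpace m) p := by
      refine Γ.hasFDerivAt_symm hpt ?_
      rw [he, hΓ]
      have : ContDiffAt ℝ r G q := by
        rw [← hΓ]; exact hΓs.contDiffAt (Γ.open_source.mem_nhds hqs)
      exact (this.differentiableAt hr0).hasFDerivAt
    have hΦd := ((consEquiv m).hasFDerivAt (x := M q)).comp p (hM'.comp p hΓd)
    have hΦd' : fderiv ℝ Φ p = _ := hΦd.fderiv
    refine twoForm_ext fun u v => ?_
    have h4 := h1 (e.symm u) (e.symm v)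
    rw [twoForm_comp_apply, ← he, hinv, ← h3, twoForm_comp_apply] at h4
    simp only [ContinuousLinearEquiv.coe_coe, ContinuousLinearEquiv.apply_symm_apply] at h4
    rw [h4, twoForm_comp_apply, hΦd']
    exact standardForm_consEquiv _ _
  · filter_upwards [hΓinv, hΓsymm.eventually hG.apply_eq_zero_iff] with p h1 h2
    rw [h1] at h2
    exact h2
  · filter_upwards [hΓinv, hΓsymm.eventually hG.apply_fun] with p h1 h2
    rw [h1] at h2
    exact h2.symm

/-- **Darboux's theorem**, by induction on the dimension: any linear functions `f`, `h` with
`{f, h} ≠ 0` at the origin split off two coordinates. -/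
theorem IsSymplectic.hasDarbouxChart (hr : r = ∞ ∨ r = ω) :
    ∀ (m : ℕ) (Ω : TwoForm m), IsSymplectic r Ω → HasDarbouxChart r Ω
  | 0, Ω, _ => by
    refine ⟨OpenPartialHomeomorph.refl _, trivial, rfl, contDiffOn_id, contDiffOn_id,
      Eventually.of_forall fun p => twoForm_ext fun u v => ?_⟩
    have hu (η : PhaseSpace 0 [⋀^Fin 2]→L[ℝ] ℝ) : η ![u, v] = 0 :=
      η.map_coord_zero (i := 0) (Subsingleton.elim _ _)
    rw [hu, hu]
  | m + 1, Ω, hΩ => by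
    have hnd := hΩ.nondegenerate.self_of_nhds
    let h : PhaseSpace (m + 1) →L[ℝ] ℝ := dx 0
    let w : PhaseSpace (m + 1) := (Pi.single 0 1, 0)
    let f : PhaseSpace (m + 1) →L[ℝ] ℝ := flat (Ω 0) w
    have hZ : hamiltonianField Ω f 0 = w := by
      refine sub_eq_zero.1 (hnd _ fun u => ?_)
      rw [← flat_apply, map_sub, sub_apply, flat_apply,
        apply_hamiltonianField _ _ _ hnd, f.fderiv, sub_self]
    have hfh : poissonBracket Ω f h 0 ≠ 0 := by
      rw [poissonBracket, hZ, h.fderiv]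
      simp [h, w, dx]
    obtain ⟨Φ, h1, h2, h3, h4, h5, -⟩ := exists_normalForm hr
      (IsSymplectic.hasDarbouxChart hr m) hΩ (smoothNear_of_contDiff f.contDiff 0)
      (smoothNear_of_contDiff h.contDiff 0) (map_zero f) (map_zero h) hfh
    exact ⟨Φ, h1, h2, h3, h4, h5⟩

end NormalForm

end SymplecticSemiSpace

theorem theorem1 (r : WithTop ℕ∞) (hr : r = ∞ ∨ r = ω) (n : ℕ) [NeZero n]
    (T : SymplecticSemiSpace.Triple n) (hT : T.IsOfClass r) (hns : T.IsNonsingular r) :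
    T.Equivalent r (SymplecticSemiSpace.normalForm n) := by
  obtain ⟨m, rfl⟩ := Nat.exists_eq_succ_of_ne_zero (NeZero.ne n)
  obtain ⟨h, hh, hfh⟩ := hns
  obtain ⟨Φ, h1, h2, h3, h4, h5, h6, h7⟩ := SymplecticSemiSpace.exists_normalForm hr
    (SymplecticSemiSpace.IsSymplectic.hasDarbouxChart hr m) hT.symplectic
    (SymplecticSemiSpace.isGerm_iff_smoothNear.1 hT.function)
    (SymplecticSemiSpace.isGerm_iff_smoothNear.1 hh.isGerm) hT.function_zero hh.map_zero hfh
  refine ⟨Φ, h1, h2, h3, h4, h5, ?_, h7⟩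
  filter_upwards [h6, hh.mem_iff] with p hp hq
  exact hq.trans hp
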